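/- Let $n\ge 1$ and $n<p<\infty$, let $q$ be given by $\frac1p+\frac1q=1$, and let $\rho$ be a finite signed Borel measure on $\mathbb{R}^n$ with compact support, $\rho(\mathbb{R}^n)=0$ and $\int_{\mathbb{R}^n}y\,d\rho(y)\ne0$. Let $\mathcal D^{1,p}(\mathbb{R}^n)$ be the space of locally integrable $u:\mathbb{R}^n\to\mathbb{R}$ whose weak gradient $Du$ is in $L^p(\mathbb{R}^n;\mathbb{R}^n)$, each $u$ being identified with its continuous representative. For $F\in L^q(\mathbb{R}^n;\mathbb{R}^n)$, write $\operatorname{div}F=\rho$ if $-\int Dv\cdot F\,dy=\int v\,d\rho$ for all $v\in\mathcal D^{1,p}(\mathbb{R}^n)$. Put $$[u]_\rho=\sup_{\mu}\frac{\left|\int u\,d\mu\right|}{\left|\int x\,d\mu(x)\right|^{1-n/p}},$$ where $\mu$ runs over the push-forwards of $\rho$ under the similarity transformations $y\mapsto\lambda Oy+z$ ($\lambda>0$, $O\in\mathrm O(n)$, $z\in\mathbb{R}^n$). Let $C_*$ be the smallest constant with $[u]_\rho\le C_*\|Du\|_p$ for all $u\in\mathcal D^{1,p}(\mathbb{R}^n)$,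 and call $v\in\mathcal D^{1,p}(\mathbb{R}^n)$ an extremal if $[v]_\rho=C_*\|Dv\|_p$. Then $$\sup_{u\in\mathcal D^{1,p},\ \|Du\|_p\le1}\left|\int_{\mathbb{R}^n}u\,d\rho\right|=\inf\left\{\|F\|_q:\ F\in L^q(\mathbb{R}^n;\mathbb{R}^n),\ \operatorname{div}F=\rho\right\},$$ where the supremum is finite and the set on the right is non-empty. Moreover, there is an extremal $v$ with $$\|Dv\|_p=1\quad\text{and}\quad[v]_\rho=\frac{\int v\,d\rho}{\left|\int y\,d\rho(y)\right|^{1-n/p}},$$ and for every such $v$ the supremum equals $\int v\,d\rho$, and there is $c>0$ such that $F=-c\,|Dv|^{p-2}Dv$ is in $L^q(\mathbb{R}^n;\mathbb{R}^n)$, satisfies $\operatorname{div}F=\rho$ and attains the infimum. -/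

import Mathlib

open MeasureTheory
open scoped ENNReal NNReal ContDiff

noncomputable section

namespace MorreyDuality

/-- `ℝⁿ` with its Euclidean norm. -/
abbrev Rn (n : ℕ) : Type := EuclideanSpace ℝ (Fin n)

/-- `G` is a weak gradient of `u` on `ℝⁿ`: both are locally integrable and
`∫ u ∂ᵢφ = - ∫ Gᵢ φ` for every test function `φ ∈ C_c^∞(ℝⁿ)` and every `i`. -/
structure HasWeakGradient {n : ℕ} (u : Rn n → ℝ) (G : Rn n → Rn n) : Prop where
  locallyIntegrable : LocallyIntegrable u volume
  locallyIntegrable_grad : LocallyIntegrable G volume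
  integral_eq : ∀ φ : Rn n → ℝ, ContDiff ℝ ∞ φ → HasCompactSupport φ → ∀ i : Fin n,
    ∫ x, u x * fderiv ℝ φ x (EuclideanSpace.single i 1) = - ∫ x, G x i * φ x

open Classical in
/-- The weak gradient `Du` (unique up to a null set); it is `0` if `u` has none. -/
def weakGrad {n : ℕ} (u : Rn n → ℝ) : Rn n → Rn n :=
  if h : ∃ G, HasWeakGradient u G then h.choose else 0

theorem hasWeakGradient_weakGrad {n : ℕ} {u : Rn n → ℝ} {G : Rn n → Rn n}
    (h : HasWeakGradient u G) : HasWeakGradient u (weakGrad u) := by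
  have h' : ∃ G, HasWeakGradient u G := ⟨G, h⟩
  rw [weakGrad, dif_pos h']
  exact h'.choose_spec

/-- The homogeneous Sobolev space `𝒟^{1,p}(ℝⁿ)`, used for `p > n`: locally integrable functions
with weak gradient in `L^p`, each identified with its continuous representative. -/
def homSobolev (n : ℕ) (p : ℝ) : Set (Rn n → ℝ) :=
  {u | Continuous u ∧ (∃ G, HasWeakGradient u G) ∧
    MemLp (weakGrad u) (ENNReal.ofReal p) volume}

/-- `‖F‖_r = (∫ |F|^r dx)^{1/r}`, used for vector fields `F ∈ L^r(ℝⁿ; ℝⁿ)`. -/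
def fieldNorm {n : ℕ} (r : ℝ) (F : Rn n → Rn n) : ℝ :=
  (∫ x, ‖F x‖ ^ r) ^ (1 / r)

/-- `∫ u dρ` for a finite signed Borel measure `ρ`. -/
def sInt {n : ℕ} (ρ : SignedMeasure (Rn n)) (u : Rn n → ℝ) : ℝ := ∫ᵛ x, u x ∂<•ρ

/-- The first moment `∫ y dρ(y) ∈ ℝⁿ`. -/
def firstMoment {n : ℕ} (ρ : SignedMeasure (Rn n)) : Rn n := ∫ᵛ y, y ∂<•ρ

/-- The standing assumptions on `ρ`: compact support, total mass zero, nonzero first moment. -/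
structure Admissible {n : ℕ} (ρ : SignedMeasure (Rn n)) : Prop where
  isCompact_support : IsCompact ρ.totalVariation.support
  mass_zero : ρ Set.univ = 0
  firstMoment_ne_zero : firstMoment ρ ≠ 0

/-- The similarity transformation `y ↦ λ O y + z`. -/
def similarity {n : ℕ} (l : ℝ) (O : Rn n ≃ₗᵢ[ℝ] Rn n) (z : Rn n) : Rn n → Rn n :=
  fun y => l • O y + z

/-- The seminorm `[u]_ρ`: the supremum of `|∫ u dμ| / |∫ x dμ|^{1-n/p}` over all push-forwards
`μ = S_# ρ` of `ρ` under similarity transformations `S`. -/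
def rhoSeminorm {n : ℕ} (p : ℝ) (ρ : SignedMeasure (Rn n)) (u : Rn n → ℝ) : ℝ≥0∞ :=
  ⨆ (l : ℝ) (_ : 0 < l) (O : Rn n ≃ₗᵢ[ℝ] Rn n) (z : Rn n),
    ENNReal.ofReal (|sInt (ρ.map (similarity l O z)) u| /
      ‖firstMoment (ρ.map (similarity l O z))‖ ^ (1 - (n : ℝ) / p))

/-- `C` is the smallest constant with `[u]_ρ ≤ C ‖Du‖_p` for all `u ∈ 𝒟^{1,p}(ℝⁿ)`. -/
def IsBestConstant {n : ℕ} (p : ℝ) (ρ : SignedMeasure (Rn n)) (C : ℝ≥0) : Prop :=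
  IsLeast {C : ℝ≥0 | ∀ u ∈ homSobolev n p,
    rhoSeminorm p ρ u ≤ C * ENNReal.ofReal (fieldNorm p (weakGrad u))} C

/-- `v` is an extremal of the generalized Morrey inequality: `[v]_ρ = C ‖Dv‖_p`, where `C` is the
best constant. -/
def IsExtremal {n : ℕ} (p : ℝ) (ρ : SignedMeasure (Rn n)) (v : Rn n → ℝ) : Prop :=
  v ∈ homSobolev n p ∧ ∃ C : ℝ≥0, IsBestConstant p ρ C ∧
    rhoSeminorm p ρ v = C * ENNReal.ofReal (fieldNorm p (weakGrad v))

/-- `v` is an extremal with `‖Dv‖_p = 1` and `[v]_ρ = ∫ v dρ / |∫ y dρ|^{1-n/p}`.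
(The seminorm of an extremal is finite.) -/
def IsNormalizedExtremal {n : ℕ} (p : ℝ) (ρ : SignedMeasure (Rn n)) (v : Rn n → ℝ) : Prop :=
  IsExtremal p ρ v ∧ fieldNorm p (weakGrad v) = 1 ∧
    (rhoSeminorm p ρ v).toReal = sInt ρ v / ‖firstMoment ρ‖ ^ (1 - (n : ℝ) / p)

/-- `div F = ρ`, tested against `𝒟^{1,p}(ℝⁿ)`: `- ∫ Dv · F dy = ∫ v dρ` for all `v`. -/
def HasDivergence {n : ℕ} (p : ℝ) (F : Rn n → Rn n) (ρ : SignedMeasure (Rn n)) : Prop :=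
  ∀ v ∈ homSobolev n p, - ∫ y, inner ℝ (weakGrad v y) (F y) = sInt ρ v

/-- The values `|∫ u dρ|`, `u ∈ 𝒟^{1,p}(ℝⁿ)` with `‖Du‖_p ≤ 1`. -/
def primalValues {n : ℕ} (p : ℝ) (ρ : SignedMeasure (Rn n)) : Set ℝ :=
  {t | ∃ u ∈ homSobolev n p, fieldNorm p (weakGrad u) ≤ 1 ∧ t = |sInt ρ u|}

/-- The fields `F ∈ L^q(ℝⁿ; ℝⁿ)` with `div F = ρ`. -/
def dualFields {n : ℕ} (p q : ℝ) (ρ : SignedMeasure (Rn n)) : Set (Rn n → Rn n) :=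
  {F | MemLp F (ENNReal.ofReal q) volume ∧ HasDivergence p F ρ}

/-- The values `‖F‖_q`, `F ∈ L^q(ℝⁿ; ℝⁿ)` with `div F = ρ`. -/
def dualValues {n : ℕ} (p q : ℝ) (ρ : SignedMeasure (Rn n)) : Set ℝ :=
  fieldNorm q '' dualFields p q ρ

end MorreyDuality

end

/-! Let M be the supremum. Everything rests on the existence of a maximizer v, since the dual field
is then read off from its Euler–Lagrange equation.

Morrey's estimate `abs_mul_integral_sub_le` controls u minus a fixed weighted average by ‖Du‖_p on
bounded sets. As ρ has mass zero, the average may be subtracted inside ∫ u dρ, so M is finite; as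
the first moment m is nonzero, a cut-off of y ↦ ⟨m, y⟩ shows M > 0. The gradients of a maximizing
sequence form a Cauchy sequence in L^p: midpoints are again nearly maximal, so their gradients have
norm near 1, and `exists_fieldNorm_sub_rpow_le` (uniform convexity) makes the differences small.
Weak gradients are closed under L^p limits, which gives v in `exists_maximizer`.

For each w, the function s ↦ M^p ‖Dv + s Dw‖_p^p - (M + s ∫ w dρ)^p is minimal at s = 0. Its
derivative there gives ∫ w dρ = M ∫ |Dv|^{p-2} Dv · Dw, so F = -M |Dv|^{p-2} Dv has divergence ρ,
and ‖F‖_q = M because (p-1)q = p. Hölder's inequality tested on v shows that no admissible field has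
smaller norm.

Finally, composing with a similarity of ratio λ multiplies ‖Du‖_p by λ^{1-n/p}, exactly as it
changes |m|^{1-n/p}. Hence C_* = M / |m|^{1-n/p}, and the normalized extremals are precisely the
maximizers (`isNormalizedExtremal_iff`). -/

namespace MorreyDuality

/-! ### Calculus of weak gradients -/

section WeakGradient

variable {n : ℕ}

theorem integrable_mul_of_hasCompactSupport {u φ : Rn n → ℝ} (hu : LocallyIntegrable u volume)
    (hφ : Continuous φ) (hc : HasCompactSupport φ) : Integrable (fun x => u x * φ x) := by
  simpa [mul_comm, smul_eq_mul] using hu.integrable_smul_left_of_hasCompactSupport hφ hc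

theorem locallyIntegrable_inner_const {G : Rn n → Rn n} (hG : LocallyIntegrable G volume)
    (w : Rn n) : LocallyIntegrable (fun x => inner ℝ (G x) w) volume := by
  intro x
  obtain ⟨s, hs, hi⟩ := hG x
  exact ⟨s, hs, hi.inner_const w⟩

theorem inner_single_one (v : Rn n) (i : Fin n) :
    inner ℝ v (EuclideanSpace.single i (1 : ℝ)) = v i := by
  simp [PiLp.inner_apply]

theorem locallyIntegrable_coord {G : Rn n → Rn n} (hG : LocallyIntegrable G volume)
    (i : Fin n) : LocallyIntegrable (fun x => G x i) volume := by
  simpa [inner_single_one] using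
    locallyIntegrable_inner_const hG (EuclideanSpace.single i (1 : ℝ))

theorem sum_smul_single (w : Rn n) : ∑ i, w i • EuclideanSpace.single i (1 : ℝ) = w := by
  simpa using (EuclideanSpace.basisFun (Fin n) ℝ).sum_repr w

theorem continuous_fderiv_apply_const {φ : Rn n → ℝ} (hφ : ContDiff ℝ ∞ φ) (w : Rn n) :
    Continuous (fun x => fderiv ℝ φ x w) :=
  (hφ.continuous_fderiv (by simp)).clm_apply continuous_const

namespace HasWeakGradient

variable {u v : Rn n → ℝ} {G H : Rn n → Rn n}

theorem integral_fderiv_apply (h : HasWeakGradient u G) {φ : Rn n → ℝ} (hφ : ContDiff ℝ ∞ φ)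
    (hc : HasCompactSupport φ) (w : Rn n) :
    ∫ x, u x * fderiv ℝ φ x w = - ∫ x, inner ℝ (G x) w * φ x := by
  have e1 : ∀ x, u x * fderiv ℝ φ x w =
      ∑ i, w i * (u x * fderiv ℝ φ x (EuclideanSpace.single i 1)) := by
    intro x
    conv_lhs => rw [← sum_smul_single w]
    simp only [map_sum, map_smul, smul_eq_mul, Finset.mul_sum]
    exact Finset.sum_congr rfl fun i _ => by ring
  have e2 : ∀ x, inner ℝ (G x) w * φ x = ∑ i, w i * (G x i * φ x) := by
    intro x
    simp only [PiLp.inner_apply, Finset.sum_mul]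
    exact Finset.sum_congr rfl fun i _ => by simp; ring
  simp only [e1, e2]
  rw [integral_finsetSum, integral_finsetSum, ← Finset.sum_neg_distrib]
  · refine Finset.sum_congr rfl fun i _ => ?_
    rw [integral_const_mul, integral_const_mul, h.integral_eq φ hφ hc i]
    ring
  · intro i _
    exact (integrable_mul_of_hasCompactSupport (locallyIntegrable_coord h.locallyIntegrable_grad i)
      hφ.continuous hc).const_mul _
  · intro i _
    exact (integrable_mul_of_hasCompactSupport h.locallyIntegrable
      (continuous_fderiv_apply_const hφ _) (hc.fderiv_apply ℝ _)).const_mul _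

/-- Each coordinate of the vector field ψ(y)(y - x) is a test function, and the left integrand is u
times the divergence of that field. This is the form in which the weak gradient enters Morrey's
estimate. -/
theorem integral_divergence_radial (h : HasWeakGradient u G) {ψ : Rn n → ℝ}
    (hψ : ContDiff ℝ ∞ ψ) (hc : HasCompactSupport ψ) (x : Rn n) :
    ∫ y, u y * (n * ψ y + fderiv ℝ ψ y (y - x)) = - ∫ y, inner ℝ (G y) (y - x) * ψ y := by
  have hproj : ∀ i : Fin n, ContDiff ℝ ∞ (fun y : Rn n => y i - x i) := fun i => by fun_prop
  have hφ : ∀ i : Fin n, ContDiff ℝ ∞ (fun y => ψ y * (y i - x i)) := fun i => hψ.mul (hproj i)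
  have hφc : ∀ i : Fin n, HasCompactSupport (fun y => ψ y * (y i - x i)) := fun i => hc.mul_right
  have hd : ∀ (i : Fin n) (y : Rn n), fderiv ℝ (fun y => ψ y * (y i - x i)) y
      (EuclideanSpace.single i 1) =
        ψ y + (y i - x i) * fderiv ℝ ψ y (EuclideanSpace.single i 1) := by
    intro i y
    have h1 : HasFDerivAt (fun y : Rn n => y i - x i) (EuclideanSpace.proj i : Rn n →L[ℝ] ℝ) y :=
      ((EuclideanSpace.proj i : Rn n →L[ℝ] ℝ).hasFDerivAt).sub_const _
    have h2 : HasFDerivAt (fun y => ψ y * (y i - x i)) _ y :=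
      ((hψ.differentiable (by simp) y).hasFDerivAt).mul h1
    rw [h2.fderiv]
    simp
  have e1 : ∀ y, u y * (n * ψ y + fderiv ℝ ψ y (y - x)) = ∑ i, u y *
      fderiv ℝ (fun y => ψ y * (y i - x i)) y (EuclideanSpace.single i 1) := by
    intro y
    conv_lhs => rw [← sum_smul_single (y - x)]
    simp only [hd, map_sum, map_smul, smul_eq_mul, ← Finset.mul_sum, Finset.sum_add_distrib]
    simp
  have e2 : ∀ y, inner ℝ (G y) (y - x) * ψ y = ∑ i, G y i * (ψ y * (y i - x i)) := by
    intro y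
    simp only [PiLp.inner_apply, Finset.sum_mul]
    exact Finset.sum_congr rfl fun i _ => by simp; ring
  simp only [e1, e2]
  rw [integral_finsetSum, integral_finsetSum, ← Finset.sum_neg_distrib]
  · exact Finset.sum_congr rfl fun i _ => h.integral_eq _ (hφ i) (hφc i) i
  · intro i _
    exact integrable_mul_of_hasCompactSupport (locallyIntegrable_coord h.locallyIntegrable_grad i)
      (hφ i).continuous (hφc i)
  · intro i _
    exact integrable_mul_of_hasCompactSupport h.locallyIntegrable
      (continuous_fderiv_apply_const (hφ i) _) ((hφc i).fderiv_apply ℝ _)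

theorem of_integral_fderiv_apply (hu : LocallyIntegrable u volume)
    (hG : LocallyIntegrable G volume)
    (h : ∀ φ : Rn n → ℝ, ContDiff ℝ ∞ φ → HasCompactSupport φ → ∀ w : Rn n,
      ∫ x, u x * fderiv ℝ φ x w = - ∫ x, inner ℝ (G x) w * φ x) : HasWeakGradient u G :=
  ⟨hu, hG, fun φ hφ hc i => by simpa [inner_single_one] using h φ hφ hc (EuclideanSpace.single i 1)⟩

/-- The fundamental lemma of the calculus of variations, coordinate by coordinate. It lets the
chosen `weakGrad` be replaced by any gradient computed by hand. -/
theorem ae_eq (h : HasWeakGradient u G) (h' : HasWeakGradient u H) : G =ᵐ[volume] H := by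
  have key : ∀ i : Fin n, ∀ᵐ x, G x i = H x i := by
    intro i
    refine ae_eq_of_integral_contDiff_smul_eq (locallyIntegrable_coord h.locallyIntegrable_grad i)
      (locallyIntegrable_coord h'.locallyIntegrable_grad i) fun φ hφ hc => ?_
    have := (h.integral_eq φ hφ hc i).symm.trans (h'.integral_eq φ hφ hc i)
    simpa [mul_comm] using this
  filter_upwards [ae_all_iff.2 key] with x hx
  ext i
  exact hx i

theorem weakGrad_ae_eq (h : HasWeakGradient u G) : weakGrad u =ᵐ[volume] G :=
  (hasWeakGradient_weakGrad h).ae_eq h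

theorem add (h : HasWeakGradient u G) (h' : HasWeakGradient v H) :
    HasWeakGradient (u + v) (G + H) := by
  refine of_integral_fderiv_apply (h.locallyIntegrable.add h'.locallyIntegrable)
    (h.locallyIntegrable_grad.add h'.locallyIntegrable_grad) fun φ hφ hc w => ?_
  have hd := continuous_fderiv_apply_const hφ w
  have hdc := hc.fderiv_apply ℝ w
  simp only [Pi.add_apply, add_mul, inner_add_left]
  rw [integral_add (integrable_mul_of_hasCompactSupport h.locallyIntegrable hd hdc)
    (integrable_mul_of_hasCompactSupport h'.locallyIntegrable hd hdc),
    integral_add (integrable_mul_of_hasCompactSupport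
      (locallyIntegrable_inner_const h.locallyIntegrable_grad w) hφ.continuous hc)
    (integrable_mul_of_hasCompactSupport
      (locallyIntegrable_inner_const h'.locallyIntegrable_grad w) hφ.continuous hc),
    h.integral_fderiv_apply hφ hc, h'.integral_fderiv_apply hφ hc]
  ring

theorem const_smul (h : HasWeakGradient u G) (c : ℝ) : HasWeakGradient (c • u) (c • G) := by
  refine of_integral_fderiv_apply (h.locallyIntegrable.smul c)
    (h.locallyIntegrable_grad.smul c) fun φ hφ hc w => ?_
  simp only [Pi.smul_apply, smul_eq_mul, inner_smul_left, mul_assoc]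
  rw [integral_const_mul, integral_const_mul, h.integral_fderiv_apply hφ hc]
  simp

end HasWeakGradient

theorem integral_fderiv_apply_eq_zero {φ : Rn n → ℝ} (hφ : ContDiff ℝ ∞ φ)
    (hc : HasCompactSupport φ) (w : Rn n) : ∫ x, fderiv ℝ φ x w = 0 := by
  have hi : Integrable (fun x => (1 : ℝ) * fderiv ℝ φ x w) := by
    simpa using (continuous_fderiv_apply_const hφ w).integrable_of_hasCompactSupport
      (hc.fderiv_apply ℝ w)
  have hi' : Integrable (fun x => (1 : ℝ) * φ x) := by
    simpa using hφ.continuous.integrable_of_hasCompactSupport hc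
  have := integral_mul_fderiv_eq_neg_fderiv_mul_of_integrable (f := fun _ : Rn n => (1 : ℝ))
    (by simp) hi hi' (fun x _ => differentiableAt_const _)
    (fun x _ => hφ.differentiable (by simp) x)
  simpa using this

theorem hasWeakGradient_const (c : ℝ) : HasWeakGradient (fun _ : Rn n => c) 0 := by
  refine .of_integral_fderiv_apply (continuous_const.locallyIntegrable)
    (continuous_const.locallyIntegrable) fun φ hφ hc w => ?_
  rw [integral_const_mul, integral_fderiv_apply_eq_zero hφ hc]
  simp

theorem hasWeakGradient_of_contDiff {u : Rn n → ℝ} (hu : ContDiff ℝ ∞ u) :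
    HasWeakGradient u (fun x => gradient u x) := by
  have hin : ∀ x w, inner ℝ (gradient u x) w = fderiv ℝ u x w := fun x w => by
    simp [gradient]
  have hgc : Continuous (fun x => gradient u x) := by
    unfold gradient
    exact (LinearIsometryEquiv.continuous _).comp (hu.continuous_fderiv (by simp))
  refine .of_integral_fderiv_apply hu.continuous.locallyIntegrable
    hgc.locallyIntegrable fun φ hφ hc w => ?_
  simp only [hin]
  refine integral_mul_fderiv_eq_neg_fderiv_mul_of_integrable ?_ ?_ ?_
    (fun x _ => hu.differentiable (by simp) x) (fun x _ => hφ.differentiable (by simp) x)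
  · exact integrable_mul_of_hasCompactSupport
      (continuous_fderiv_apply_const hu w).locallyIntegrable hφ.continuous hc
  · exact integrable_mul_of_hasCompactSupport hu.continuous.locallyIntegrable
      (continuous_fderiv_apply_const hφ w) (hc.fderiv_apply ℝ w)
  · exact integrable_mul_of_hasCompactSupport hu.continuous.locallyIntegrable hφ.continuous hc

end WeakGradient

open Set Metric Filter Topology

/-! ### Morrey's pointwise estimate -/

section Morrey

variable {n : ℕ}

theorem integral_comp_dilation (f : Rn n → ℝ) (x : Rn n) {t : ℝ} (ht : 0 < t) :
    ∫ y, f (x + t⁻¹ • (y - x)) = t ^ n * ∫ y, f y := by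
  rw [integral_sub_right_eq_self (fun y => f (x + t⁻¹ • y)) x,
    Measure.integral_comp_inv_smul_of_nonneg volume (fun y => f (x + y)) ht.le,
    integral_add_left_eq_self f x]
  simp

theorem hasCompactSupport_comp_dilation {f : Rn n → ℝ} (hf : HasCompactSupport f) (x : Rn n)
    {t : ℝ} (ht : 0 < t) : HasCompactSupport (fun y => f (x + t⁻¹ • (y - x))) :=
  hf.comp_homeomorph ((Homeomorph.subRight x).trans
    ((Homeomorph.smulOfNeZero t⁻¹ (inv_ne_zero ht.ne')).trans (Homeomorph.addLeft x)))

theorem contDiff_comp_dilation {f : Rn n → ℝ} (hf : ContDiff ℝ ∞ f) (x : Rn n) (t : ℝ) :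
    ContDiff ℝ ∞ (fun y => f (x + t⁻¹ • (y - x))) :=
  hf.comp (by fun_prop)

theorem hasDerivAt_dilated_kernel {η : Rn n → ℝ} (hη : ContDiff ℝ ∞ η) (x y : Rn n) {t : ℝ}
    (ht : 0 < t) :
    HasDerivAt (fun t : ℝ => (t ^ n)⁻¹ * η (x + t⁻¹ • (y - x)))
      (-((t ^ (n + 1))⁻¹ * (n * η (x + t⁻¹ • (y - x)) +
        fderiv ℝ η (x + t⁻¹ • (y - x)) (t⁻¹ • (y - x))))) t := by
  have h1 : HasDerivAt (fun t : ℝ => x + t⁻¹ • (y - x)) ((-(t ^ 2)⁻¹) • (y - x)) t :=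
    ((hasDerivAt_inv ht.ne').smul_const (y - x)).const_add x
  have h2 : HasDerivAt (fun t : ℝ => η (x + t⁻¹ • (y - x)))
      (fderiv ℝ η (x + t⁻¹ • (y - x)) ((-(t ^ 2)⁻¹) • (y - x))) t :=
    ((hη.differentiable (by simp) _).hasFDerivAt).comp_hasDerivAt t h1
  have h3 : HasDerivAt (fun t : ℝ => (t ^ n)⁻¹) (-(n * t ^ (n - 1)) / (t ^ n) ^ 2) t :=
    (hasDerivAt_pow n t).inv (by positivity)
  refine (h3.mul h2).congr_deriv ?_
  simp only [map_smul, smul_eq_mul]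
  rcases n with _ | m
  · field_simp
    simp
    ring
  · simp only [Nat.add_sub_cancel]
    field_simp
    ring

/-- With the dilation placed on the kernel, differentiation in t falls on the smooth η, so u need
only be locally integrable. -/
theorem hasDerivAt_integral_dilated_kernel {u : Rn n → ℝ} (hu : LocallyIntegrable u volume)
    {η : Rn n → ℝ} (hη : ContDiff ℝ ∞ η) (hc : HasCompactSupport η) (x : Rn n) {t₀ : ℝ}
    (ht₀ : 0 < t₀) :
    HasDerivAt (fun t : ℝ => ∫ y, u y * ((t ^ n)⁻¹ * η (x + t⁻¹ • (y - x))))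
      (∫ y, u y * (-((t₀ ^ (n + 1))⁻¹ * (n * η (x + t₀⁻¹ • (y - x)) +
        fderiv ℝ η (x + t₀⁻¹ • (y - x)) (t₀⁻¹ • (y - x)))))) t₀ := by
  set θ : Rn n → ℝ := fun w => n * η w + fderiv ℝ η w (w - x) with hθ
  have hθc : Continuous θ := (continuous_const.mul hη.continuous).add
    ((hη.continuous_fderiv (by simp)).clm_apply (by fun_prop))
  have hθs : HasCompactSupport θ := by
    refine hc.mul_left.add ?_
    refine (hc.fderiv (𝕜 := ℝ)).mono fun w hw => ?_
    contrapose! hw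
    simp only [Function.mem_support, not_not] at hw ⊢
    simp [hw]
  have hθz : ∀ (t : ℝ) (y : Rn n), n * η (x + t⁻¹ • (y - x)) +
      fderiv ℝ η (x + t⁻¹ • (y - x)) (t⁻¹ • (y - x)) = θ (x + t⁻¹ • (y - x)) := by
    intro t y
    simp [hθ]
  obtain ⟨A, hA⟩ := hθs.exists_bound_of_continuous hθc
  have hA0 : 0 ≤ A := (norm_nonneg _).trans (hA x)
  obtain ⟨R, hR⟩ := hθs.isCompact.isBounded.subset_closedBall x
  -- For t < 2t₀ the dilated kernels are all supported in this one ball, and t > t₀/2 bounds the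
  -- negative power of t; together they give an integrable majorant.
  set K := closedBall x (2 * t₀ * R)
  have hs : Ioo (t₀ / 2) (2 * t₀) ∈ 𝓝 t₀ := Ioo_mem_nhds (by linarith) (by linarith)
  have hpos : ∀ t ∈ Ioo (t₀ / 2) (2 * t₀), 0 < t := fun t h => by linarith [h.1]
  have hint : ∀ t, 0 < t →
      Integrable (fun y => u y * ((t ^ n)⁻¹ * η (x + t⁻¹ • (y - x)))) := fun t ht =>
    integrable_mul_of_hasCompactSupport hu
      (continuous_const.mul (contDiff_comp_dilation hη x t).continuous)
      (hasCompactSupport_comp_dilation hc x ht).mul_left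
  refine (hasDerivAt_integral_of_dominated_loc_of_deriv_le (μ := volume)
    (F := fun t y => u y * ((t ^ n)⁻¹ * η (x + t⁻¹ • (y - x))))
    (F' := fun t y => u y * (-((t ^ (n + 1))⁻¹ * (n * η (x + t⁻¹ • (y - x)) +
        fderiv ℝ η (x + t⁻¹ • (y - x)) (t⁻¹ • (y - x))))))
    (bound := K.indicator fun y => ‖u y‖ * (((t₀ / 2) ^ (n + 1))⁻¹ * A))
    hs ?_ (hint t₀ ht₀) ?_ ?_ ?_ ?_).2
  · filter_upwards [hs] with t ht using (hint t (hpos t ht)).aestronglyMeasurable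
  · simp only [hθz]
    refine hu.aestronglyMeasurable.mul (Continuous.aestronglyMeasurable ?_)
    fun_prop
  · refine Eventually.of_forall fun y t ht => ?_
    have htp := hpos t ht
    rw [hθz]
    by_cases hy : y ∈ K
    · rw [indicator_of_mem hy, norm_mul, norm_neg, norm_mul,
        Real.norm_of_nonneg (r := (t ^ (n + 1))⁻¹) (by positivity)]
      gcongr
      · exact ht.1.le
      · exact hA _
    · rw [indicator_of_notMem hy]
      have : θ (x + t⁻¹ • (y - x)) = 0 := by
        by_contra hne
        have h1 := hR (subset_tsupport _ hne)
        rw [mem_closedBall, dist_eq_norm, add_sub_cancel_left, norm_smul, norm_inv,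
          Real.norm_of_nonneg htp.le, inv_mul_le_iff₀ htp] at h1
        refine hy ?_
        rw [mem_closedBall, dist_eq_norm]
        have hR0 : 0 ≤ R := by
          by_contra hR0
          push Not at hR0
          nlinarith [norm_nonneg (y - x)]
        nlinarith [ht.2]
      simp [this]
  · rw [integrable_indicator_iff measurableSet_closedBall]
    exact ((hu.integrableOn_isCompact (isCompact_closedBall _ _)).norm).mul_const _
  · refine Eventually.of_forall fun y t ht => ?_
    exact (hasDerivAt_dilated_kernel hη x y (hpos t ht)).const_mul (u y)

theorem fieldNorm_nonneg (r : ℝ) (F : Rn n → Rn n) : 0 ≤ fieldNorm r F :=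
  Real.rpow_nonneg (integral_nonneg fun _ => Real.rpow_nonneg (norm_nonneg _) _) _

theorem abs_integral_inner_le {p q : ℝ} (hpq : p.HolderConjugate q) {F G : Rn n → Rn n}
    (hF : MemLp F (ENNReal.ofReal p) volume) (hG : MemLp G (ENNReal.ofReal q) volume) :
    |∫ y, inner ℝ (F y) (G y)| ≤ fieldNorm p F * fieldNorm q G := by
  have : ENNReal.HolderConjugate (ENNReal.ofReal p) (ENNReal.ofReal q) := by
    exact hpq.ennrealOfReal
  calc |∫ y, inner ℝ (F y) (G y)| ≤ ∫ y, ‖F y‖ * ‖G y‖ := by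
        rw [← Real.norm_eq_abs]
        refine norm_integral_le_of_norm_le (g := fun y => ‖F y‖ * ‖G y‖)
          (hF.norm.integrable_mul hG.norm) (Eventually.of_forall fun y => ?_)
        exact norm_inner_le_norm _ _
    _ ≤ _ := integral_mul_norm_le_Lp_mul_Lq hpq hF hG

/-- The change of variables contributes n/q to the exponent and the kernel contributes -n; the total
is -n/p, which exceeds -1 exactly when p > n. -/
theorem fieldNorm_dilated {p q : ℝ} (hpq : p.HolderConjugate q) (η : Rn n → ℝ) (x : Rn n)
    {t : ℝ} (ht : 0 < t) :
    fieldNorm q (fun y => ((t ^ (n + 1))⁻¹ * η (x + t⁻¹ • (y - x))) • (y - x)) =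
      t ^ (-(n : ℝ) / p) * fieldNorm q (fun w => η w • (w - x)) := by
  have hq := hpq.symm.pos
  have h1 : ∀ y, ‖((t ^ (n + 1))⁻¹ * η (x + t⁻¹ • (y - x))) • (y - x)‖ ^ q =
      ((t ^ n)⁻¹) ^ q *
        ‖η (x + t⁻¹ • (y - x)) • ((x + t⁻¹ • (y - x)) - x)‖ ^ q := by
    intro y
    rw [← Real.mul_rpow (by positivity) (norm_nonneg _), add_sub_cancel_left, norm_smul, norm_smul,
      norm_smul, norm_mul, Real.norm_of_nonneg (r := (t ^ (n + 1))⁻¹) (by positivity),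
      Real.norm_of_nonneg (r := t⁻¹) (by positivity)]
    congr 1
    field_simp
    ring
  unfold fieldNorm
  simp only [h1]
  rw [integral_const_mul, integral_comp_dilation (fun w => ‖η w • (w - x)‖ ^ q) x ht, ← mul_assoc,
    Real.mul_rpow (by positivity) (integral_nonneg fun _ => by positivity)]
  congr 1
  rw [← Real.rpow_natCast, ← Real.rpow_neg ht.le, ← Real.rpow_mul ht.le, ← Real.rpow_add ht,
    ← Real.rpow_mul ht.le]
  congr 1
  have := hpq.inv_add_inv_eq_one
  have hq0 := hq.ne'
  have hp0 := hpq.pos.ne'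
  field_simp at this ⊢
  linear_combination (n : ℝ) * this

theorem memLp_smul_sub {η : Rn n → ℝ} (hη : Continuous η) (hc : HasCompactSupport η) (x : Rn n)
    (r : ℝ≥0∞) : MemLp (fun w => η w • (w - x)) r volume :=
  Continuous.memLp_of_hasCompactSupport (by fun_prop) hc.smul_right

/-- The pointwise Morrey estimate: a continuous function with weak gradient in `L^p`, `p > n`,
differs from a fixed weighted average by at most a multiple of `‖Du‖_p`. -/
theorem abs_mul_integral_sub_le {p q : ℝ} (hp : (n : ℝ) < p) (hpq : p.HolderConjugate q)
    {u : Rn n → ℝ} {G : Rn n → Rn n} (hu : Continuous u) (h : HasWeakGradient u G)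
    (hG : MemLp G (ENNReal.ofReal p) volume)
    {η : Rn n → ℝ} (hη : ContDiff ℝ ∞ η) (hc : HasCompactSupport η) (x : Rn n) :
    |(∫ y, u y * η y) - u x * ∫ y, η y| ≤
      fieldNorm p G * fieldNorm q (fun w => η w • (w - x)) / (1 - n / p) := by
  have hp0 := hpq.pos
  have hα : 0 < 1 - (n : ℝ) / p := by rw [sub_pos, div_lt_one hp0]; exact hp
  -- This path of averages joins u(x) ∫ η at t = 0 to ∫ u η at t = 1, and its derivative is
  -- O(t^{-n/p}), integrable at 0. No smoothing of u is needed.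
  set f : ℝ → ℝ := fun t => ∫ w, u (x + t • (w - x)) * η w with hf
  set C := fieldNorm p G * fieldNorm q (fun w => η w • (w - x)) with hC
  have hfc : Continuous f := by
    have : f = fun t => ∫ w in tsupport η, u (x + t • (w - x)) * η w := by
      funext t
      refine (setIntegral_eq_integral_of_forall_compl_eq_zero fun w hw => ?_).symm
      rw [image_eq_zero_of_notMem_tsupport hw, mul_zero]
    rw [this]
    refine continuous_parametric_integral_of_continuous ?_ hc.isCompact
    have := hη.continuous
    simp only [Function.uncurry_def]
    fun_prop
  have hfe : ∀ t, 0 < t → f t = ∫ y, u y * ((t ^ n)⁻¹ * η (x + t⁻¹ • (y - x))) := by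
    intro t ht
    have := integral_comp_dilation (fun w => u (x + t • (w - x)) * η w) x ht
    rw [hf]
    simp only
    rw [eq_comm, ← mul_right_inj' (pow_pos ht n).ne', ← this, ← integral_const_mul]
    congr 1
    funext y
    simp only [add_sub_cancel_left, smul_smul, mul_inv_cancel₀ ht.ne', one_smul,
      add_sub_cancel]
    field_simp
  have hfd : ∀ t, 0 < t → ∃ d, |d| ≤ C * t ^ (-(n : ℝ) / p) ∧ HasDerivAt f d t := by
    intro t ht
    have hd := hasDerivAt_integral_dilated_kernel h.locallyIntegrable hη hc x ht
    refine ⟨_, ?_, hd.congr_of_eventuallyEq ?_⟩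
    · have hψ : ContDiff ℝ ∞ (fun y => (t ^ (n + 1))⁻¹ * η (x + t⁻¹ • (y - x))) :=
        contDiff_const.mul (contDiff_comp_dilation hη x t)
      have hψc : HasCompactSupport (fun y => (t ^ (n + 1))⁻¹ * η (x + t⁻¹ • (y - x))) :=
        (hasCompactSupport_comp_dilation hc x ht).mul_left
      have hψd : ∀ y, fderiv ℝ (fun y => (t ^ (n + 1))⁻¹ * η (x + t⁻¹ • (y - x))) y (y - x) =
          (t ^ (n + 1))⁻¹ * fderiv ℝ η (x + t⁻¹ • (y - x)) (t⁻¹ • (y - x)) := by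
        intro y
        have h1 : HasFDerivAt (fun y => x + t⁻¹ • (y - x)) (t⁻¹ • ContinuousLinearMap.id ℝ (Rn n))
            y := (((hasFDerivAt_id y).sub_const x).const_smul t⁻¹).const_add x
        have h2 := (((hη.differentiable (by simp) (x + t⁻¹ • (y - x))).hasFDerivAt).comp y
          h1).const_mul (t ^ (n + 1))⁻¹
        have h3 : HasFDerivAt (fun y => (t ^ (n + 1))⁻¹ * η (x + t⁻¹ • (y - x))) _ y := h2
        rw [h3.fderiv]
        simp
      have e := h.integral_divergence_radial hψ hψc x
      simp only [hψd] at e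
      have e' : ∫ y, u y * (-((t ^ (n + 1))⁻¹ * (n * η (x + t⁻¹ • (y - x)) +
          fderiv ℝ η (x + t⁻¹ • (y - x)) (t⁻¹ • (y - x))))) =
          ∫ y, inner ℝ (G y) (((t ^ (n + 1))⁻¹ * η (x + t⁻¹ • (y - x))) • (y - x)) := by
        calc _ = - ∫ y, u y * (n * ((t ^ (n + 1))⁻¹ * η (x + t⁻¹ • (y - x))) +
              (t ^ (n + 1))⁻¹ * fderiv ℝ η (x + t⁻¹ • (y - x)) (t⁻¹ • (y - x))) := by
              rw [← integral_neg]
              congr 1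
              funext y
              ring
          _ = _ := by
              rw [e, neg_neg]
              congr 1
              funext y
              rw [inner_smul_right, mul_comm]
      rw [e', hC, mul_assoc, mul_comm (fieldNorm q _), ← fieldNorm_dilated hpq η x ht]
      exact abs_integral_inner_le hpq hG (memLp_smul_sub hψ.continuous hψc x _)
    · filter_upwards [lt_mem_nhds ht] with s hs using hfe s hs
  choose! d hdb hd using hfd
  -- Time is reversed, s = 1 - t, so that the singular time t = 0 becomes the right endpoint, where
  -- no derivative is required. The barrier is the integral of C (1 - s)^{-n/p}.
  have key := image_norm_le_of_norm_deriv_right_le_deriv_boundary'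
    (f := fun s => f (1 - s) - f 1) (f' := fun s => -d (1 - s)) (a := 0) (b := 1)
    (B := fun s => C / (1 - n / p) * (1 - (1 - s) ^ (1 - (n : ℝ) / p)))
    (B' := fun s => C * (1 - s) ^ (-(n : ℝ) / p))
    (by fun_prop) ?_ (by simp) ?_ ?_ ?_ (right_mem_Icc.2 zero_le_one)
  · simp only [sub_self, Real.zero_rpow hα.ne', sub_zero, mul_one] at key
    have h0 : f 0 = u x * ∫ y, η y := by simp [hf, integral_const_mul]
    have h1 : f 1 = ∫ y, u y * η y := by simp [hf]
    rw [← h0, ← h1, abs_sub_comm]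
    exact key
  · intro s hs
    have : HasDerivAt (fun s => f (1 - s) - f 1) (-d (1 - s)) s := by
      have h1 := (hd (1 - s) (by linarith [hs.2]))
      have h2 : HasDerivAt (fun s : ℝ => 1 - s) (-1) s := by
        simpa using (hasDerivAt_id s).const_sub 1
      simpa using (h1.comp s h2).sub_const (f 1)
    exact this.hasDerivWithinAt
  · refine Continuous.continuousOn ?_
    refine continuous_const.mul (continuous_const.sub ?_)
    exact (continuous_const.sub continuous_id).rpow_const fun _ => Or.inr hα.le
  · intro s hs
    have h2 : HasDerivAt (fun s : ℝ => 1 - s) (-1) s := by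
      simpa using (hasDerivAt_id s).const_sub 1
    have h3 := (h2.rpow_const (p := 1 - (n : ℝ) / p) (Or.inl (by linarith [hs.2]))).const_sub 1
    refine ((h3.const_mul (C / (1 - n / p))).congr_deriv ?_).hasDerivWithinAt
    have : 1 - (n : ℝ) / p - 1 = -n / p := by ring
    rw [this]
    generalize (1 - s) ^ (-(n : ℝ) / p) = Z
    linear_combination (C * Z) * div_mul_cancel₀ 1 hα.ne'
  · intro s hs
    rw [norm_neg]
    exact hdb _ (by linarith [hs.2])

end Morrey

/-! ### Uniform convexity of the p-th power of a norm -/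

section UniformConvexity

theorem norm_midpoint_rpow_le {E : Type*} [NormedAddCommGroup E] [NormedSpace ℝ E] {p : ℝ}
    (hp : 1 < p) (a b : E) : ‖(2⁻¹ : ℝ) • (a + b)‖ ^ p ≤ (‖a‖ ^ p + ‖b‖ ^ p) / 2 := by
  have h1 : ‖(2⁻¹ : ℝ) • (a + b)‖ ≤ (2⁻¹ : ℝ) • ‖a‖ + (2⁻¹ : ℝ) • ‖b‖ := by
    rw [norm_smul, ← smul_add, smul_eq_mul]
    norm_num
    exact norm_add_le a b
  have h2 := (convexOn_rpow hp.le).2 (norm_nonneg a) (norm_nonneg b)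
    (by norm_num : (0 : ℝ) ≤ 2⁻¹) (by norm_num : (0 : ℝ) ≤ 2⁻¹) (by norm_num)
  refine (Real.rpow_le_rpow (norm_nonneg _) h1 (by linarith)).trans (h2.trans_eq ?_)
  simp only [smul_eq_mul]
  ring

theorem eq_of_norm_midpoint_rpow_eq {E : Type*} [NormedAddCommGroup E] [NormedSpace ℝ E]
    [StrictConvexSpace ℝ E] {p : ℝ} (hp : 1 < p) {a b : E}
    (h : (‖a‖ ^ p + ‖b‖ ^ p) / 2 ≤ ‖(2⁻¹ : ℝ) • (a + b)‖ ^ p) : a = b := by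
  have h1 : ‖(2⁻¹ : ℝ) • (a + b)‖ ≤ (2⁻¹ : ℝ) • ‖a‖ + (2⁻¹ : ℝ) • ‖b‖ := by
    rw [norm_smul, ← smul_add, smul_eq_mul]
    norm_num
    exact norm_add_le a b
  have hn : ‖a‖ = ‖b‖ := by
    by_contra hne
    have h2 := (strictConvexOn_rpow hp).2 (norm_nonneg a) (norm_nonneg b) hne
      (by norm_num : (0 : ℝ) < 2⁻¹) (by norm_num : (0 : ℝ) < 2⁻¹) (by norm_num)
    have h3 := Real.rpow_le_rpow (norm_nonneg _) h1 (by linarith : 0 ≤ p)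
    simp only [smul_eq_mul] at h2 h3
    linarith
  refine eq_of_norm_eq_of_norm_add_eq hn (le_antisymm (norm_add_le _ _) ?_)
  rw [hn, add_self_div_two] at h
  have h4 := (Real.rpow_le_rpow_iff (norm_nonneg _) (norm_nonneg _) (by linarith)).1 h
  rw [norm_smul] at h4
  norm_num at h4
  linarith

/-- A compactness substitute for Clarkson's inequalities, uniform in p > 1. Both sides are
p-homogeneous, so the pair may be normalized. On the compact set where the difference is at least ε,
the convexity defect is positive by strict convexity, so the quotient is bounded; elsewhere the ε
term suffices. -/
theorem exists_norm_sub_rpow_le {E : Type*} [NormedAddCommGroup E] [NormedSpace ℝ E]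
    [StrictConvexSpace ℝ E] [FiniteDimensional ℝ E] {p : ℝ} (hp : 1 < p) {ε : ℝ} (hε : 0 < ε) :
    ∃ C : ℝ, 0 ≤ C ∧ ∀ a b : E, ‖a - b‖ ^ p ≤ ε * (‖a‖ ^ p + ‖b‖ ^ p) +
      C * ((‖a‖ ^ p + ‖b‖ ^ p) / 2 - ‖(2⁻¹ : ℝ) • (a + b)‖ ^ p) := by
  have hp0 : 0 < p := by linarith
  have hc : Continuous fun t : ℝ => t ^ p := Real.continuous_rpow_const hp0.le
  set N : E × E → ℝ := fun z => ‖z.1‖ ^ p + ‖z.2‖ ^ p with hN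
  set Φ : E × E → ℝ := fun z => N z / 2 - ‖(2⁻¹ : ℝ) • (z.1 + z.2)‖ ^ p with hΦ
  set D : E × E → ℝ := fun z => ‖z.1 - z.2‖ ^ p with hD
  have hNc : Continuous N :=
    (hc.comp (by fun_prop : Continuous fun z : E × E => ‖z.1‖)).add
      (hc.comp (by fun_prop : Continuous fun z : E × E => ‖z.2‖))
  have hΦc : Continuous Φ := (hNc.div_const 2).sub
    (hc.comp (by fun_prop : Continuous fun z : E × E => ‖(2⁻¹ : ℝ) • (z.1 + z.2)‖))
  have hDc : Continuous D := hc.comp (by fun_prop : Continuous fun z : E × E => ‖z.1 - z.2‖)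
  have hΦ0 : ∀ z, 0 ≤ Φ z := fun z => sub_nonneg.2 (norm_midpoint_rpow_le hp _ _)
  set T : Set (E × E) := {z | N z = 1 ∧ ε ≤ D z} with hT
  have hTc : IsCompact T := by
    refine Metric.isCompact_of_isClosed_isBounded
      ((isClosed_eq hNc continuous_const).inter (isClosed_le continuous_const hDc)) ?_
    refine (Metric.isBounded_closedBall (x := (0 : E × E)) (r := 1)).subset fun z hz => ?_
    have h1 : ‖z.1‖ ^ p ≤ 1 := by
      rw [← hz.1]; exact le_add_of_nonneg_right (by positivity)
    have h2 : ‖z.2‖ ^ p ≤ 1 := by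
      rw [← hz.1]; exact le_add_of_nonneg_left (by positivity)
    rw [mem_closedBall_zero_iff, Prod.norm_def, max_le_iff]
    rw [← Real.one_rpow p] at h1 h2
    exact ⟨(Real.rpow_le_rpow_iff (norm_nonneg _) zero_le_one hp0).1 h1,
      (Real.rpow_le_rpow_iff (norm_nonneg _) zero_le_one hp0).1 h2⟩
  have hTpos : ∀ z ∈ T, 0 < Φ z := by
    intro z hz
    refine (hΦ0 z).lt_of_ne fun h0 => ?_
    have : z.1 = z.2 := eq_of_norm_midpoint_rpow_eq hp (sub_nonpos.1 h0.symm.le)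
    have h2 := hz.2
    simp only [hD, this, sub_self, norm_zero, Real.zero_rpow hp0.ne'] at h2
    linarith
  obtain ⟨C, hC0, hC⟩ : ∃ C : ℝ, 0 ≤ C ∧ ∀ z ∈ T, D z ≤ C * Φ z := by
    have hcont : ContinuousOn (fun z => D z / Φ z) T :=
      hDc.continuousOn.div hΦc.continuousOn fun z hz => (hTpos z hz).ne'
    obtain ⟨C, hC⟩ := hTc.exists_bound_of_continuousOn hcont
    refine ⟨max C 0, le_max_right _ _, fun z hz => ?_⟩
    have := (le_abs_self _).trans ((hC z hz).trans (le_max_left C 0))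
    rwa [div_le_iff₀ (hTpos z hz)] at this
  refine ⟨C, hC0, fun a b => ?_⟩
  change D (a, b) ≤ ε * N (a, b) + C * Φ (a, b)
  rcases (by positivity : 0 ≤ N (a, b)).eq_or_lt with h0 | h0
  · have ha : ‖a‖ ^ p = 0 := by
      have : 0 ≤ ‖a‖ ^ p := by positivity
      have : 0 ≤ ‖b‖ ^ p := by positivity
      simp only [hN] at h0; linarith
    have hb : ‖b‖ ^ p = 0 := by simp only [hN] at h0; linarith
    rw [Real.rpow_eq_zero (norm_nonneg _) hp0.ne', norm_eq_zero] at ha hb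
    have : D (a, b) = 0 := by simp [hD, ha, hb, hp0.ne']
    rw [this, ← h0]
    have := mul_nonneg hC0 (hΦ0 (a, b))
    linarith
  -- This scaling factor makes the sum of the p-th powers of the two norms equal to 1.
  · set s : ℝ := (N (a, b) ^ p⁻¹)⁻¹ with hs
    have hs0 : 0 < s := by positivity
    have hsp : s ^ p * N (a, b) = 1 := by
      rw [hs, Real.inv_rpow (by positivity), Real.rpow_inv_rpow h0.le hp0.ne',
        inv_mul_cancel₀ h0.ne']
    have hscale : ∀ v : E, ‖s • v‖ ^ p = s ^ p * ‖v‖ ^ p := fun v => by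
      rw [norm_smul, Real.norm_of_nonneg hs0.le, Real.mul_rpow hs0.le (norm_nonneg _)]
    have hN' : N (s • a, s • b) = s ^ p * N (a, b) := by simp only [hN, hscale]; ring
    have hD' : D (s • a, s • b) = s ^ p * D (a, b) := by simp only [hD, ← smul_sub, hscale]
    have hΦ' : Φ (s • a, s • b) = s ^ p * Φ (a, b) := by
      simp only [hΦ, hN']
      rw [← smul_add, smul_comm, hscale]
      ring
    have hsp0 : 0 < s ^ p := by positivity
    have key : D (s • a, s • b) ≤ ε * N (s • a, s • b) + C * Φ (s • a, s • b) := by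
      rw [hN', hsp, mul_one]
      by_cases hz : ε ≤ D (s • a, s • b)
      · have := hC (s • a, s • b) ⟨by rw [hN', hsp], hz⟩
        linarith
      · have := mul_nonneg hC0 (hΦ0 (s • a, s • b))
        linarith
    rw [hN', hD', hΦ'] at key
    refine le_of_mul_le_mul_left ?_ hsp0
    linarith

end UniformConvexity

/-! ### The L^p norm of vector fields -/

section FieldNorm

variable {n : ℕ} {p : ℝ} {F G : Rn n → Rn n}

theorem integrable_norm_rpow (hp : 0 < p) (hF : MemLp F (ENNReal.ofReal p) volume) :
    Integrable fun x => ‖F x‖ ^ p := by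
  have := hF.integrable_norm_rpow (by simpa using hp) (by simp)
  rwa [ENNReal.toReal_ofReal hp.le] at this

theorem fieldNorm_rpow (hp : 0 < p) (F : Rn n → Rn n) : fieldNorm p F ^ p = ∫ x, ‖F x‖ ^ p := by
  rw [fieldNorm, one_div, Real.rpow_inv_rpow (integral_nonneg fun _ => by positivity) hp.ne']

theorem fieldNorm_eq_norm_toLp (hp : 0 < p) (hF : MemLp F (ENNReal.ofReal p) volume) :
    fieldNorm p F = ‖hF.toLp F‖ := by
  rw [Lp.norm_toLp, hF.eLpNorm_eq_integral_rpow_norm (by simpa using hp) (by simp),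
    ENNReal.toReal_ofReal hp.le, ENNReal.toReal_ofReal
      (Real.rpow_nonneg (integral_nonneg fun _ => by positivity) _), fieldNorm, one_div]

theorem fieldNorm_congr_ae (h : F =ᵐ[volume] G) : fieldNorm p F = fieldNorm p G := by
  unfold fieldNorm
  congr 1
  refine integral_congr_ae ?_
  filter_upwards [h] with x hx
  rw [hx]

theorem fieldNorm_smul (hp : 0 < p) (c : ℝ) (F : Rn n → Rn n) :
    fieldNorm p (c • F) = |c| * fieldNorm p F := by
  unfold fieldNorm
  simp only [Pi.smul_apply, norm_smul, Real.norm_eq_abs,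
    Real.mul_rpow (abs_nonneg c) (norm_nonneg _)]
  rw [integral_const_mul, Real.mul_rpow (by positivity) (integral_nonneg fun _ => by positivity),
    one_div, Real.rpow_rpow_inv (abs_nonneg c) hp.ne']

theorem fieldNorm_add_le (hp : 1 ≤ p) (hF : MemLp F (ENNReal.ofReal p) volume)
    (hG : MemLp G (ENNReal.ofReal p) volume) :
    fieldNorm p (F + G) ≤ fieldNorm p F + fieldNorm p G := by
  have hp0 : 0 < p := by linarith
  have : Fact ((1 : ℝ≥0∞) ≤ ENNReal.ofReal p) := ⟨by simpa using hp⟩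
  rw [fieldNorm_eq_norm_toLp hp0 hF, fieldNorm_eq_norm_toLp hp0 hG,
    fieldNorm_eq_norm_toLp hp0 (hF.add hG), MemLp.toLp_add]
  exact norm_add_le _ _

/-- The pointwise inequality integrates because its constant does not depend on the two vectors. -/
theorem exists_fieldNorm_sub_rpow_le (n : ℕ) (hp : 1 < p) {ε : ℝ} (hε : 0 < ε) :
    ∃ C : ℝ, 0 ≤ C ∧ ∀ F G : Rn n → Rn n, MemLp F (ENNReal.ofReal p) volume →
      MemLp G (ENNReal.ofReal p) volume →
      fieldNorm p (F - G) ^ p ≤ ε * (fieldNorm p F ^ p + fieldNorm p G ^ p) +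
        C * ((fieldNorm p F ^ p + fieldNorm p G ^ p) / 2 -
          fieldNorm p ((2⁻¹ : ℝ) • (F + G)) ^ p) := by
  have hp0 : 0 < p := by linarith
  obtain ⟨C, hC0, hC⟩ := exists_norm_sub_rpow_le (E := Rn n) hp hε
  refine ⟨C, hC0, fun F G hF hG => ?_⟩
  have iF := integrable_norm_rpow hp0 hF
  have iG := integrable_norm_rpow hp0 hG
  have iM := integrable_norm_rpow hp0 ((hF.add hG).const_smul (2⁻¹ : ℝ))
  have i1 : Integrable fun x => ‖F x‖ ^ p + ‖G x‖ ^ p := iF.add iG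
  have i2 : Integrable fun x => (‖F x‖ ^ p + ‖G x‖ ^ p) / 2 -
    ‖((2⁻¹ : ℝ) • (F + G)) x‖ ^ p := (i1.div_const 2).sub iM
  simp only [fieldNorm_rpow hp0]
  rw [← integral_add iF iG, ← integral_div, ← integral_sub (i1.div_const 2) iM,
    ← integral_const_mul, ← integral_const_mul, ← integral_add (i1.const_mul ε) (i2.const_mul C)]
  refine integral_mono (integrable_norm_rpow hp0 (hF.sub hG))
    ((i1.const_mul ε).add (i2.const_mul C)) fun x => ?_
  exact hC (F x) (G x)

end FieldNorm

/-! ### Linear structure of the homogeneous Sobolev space -/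

section HomSobolev

variable {n : ℕ} {p : ℝ} {u v : Rn n → ℝ} {G : Rn n → Rn n}

theorem mem_homSobolev (hu : Continuous u) (h : HasWeakGradient u G)
    (hG : MemLp G (ENNReal.ofReal p) volume) : u ∈ homSobolev n p :=
  ⟨hu, ⟨G, h⟩, (memLp_congr_ae h.weakGrad_ae_eq).2 hG⟩

theorem hasWeakGradient_of_mem_homSobolev (hu : u ∈ homSobolev n p) :
    HasWeakGradient u (weakGrad u) :=
  hasWeakGradient_weakGrad hu.2.1.choose_spec

theorem memLp_weakGrad (hu : u ∈ homSobolev n p) :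
    MemLp (weakGrad u) (ENNReal.ofReal p) volume := hu.2.2

theorem fieldNorm_weakGrad (h : HasWeakGradient u G) :
    fieldNorm p (weakGrad u) = fieldNorm p G := fieldNorm_congr_ae h.weakGrad_ae_eq

theorem hasWeakGradient_add (hu : u ∈ homSobolev n p) (hv : v ∈ homSobolev n p) :
    HasWeakGradient (u + v) (weakGrad u + weakGrad v) :=
  (hasWeakGradient_of_mem_homSobolev hu).add (hasWeakGradient_of_mem_homSobolev hv)

theorem hasWeakGradient_smul (hu : u ∈ homSobolev n p) (c : ℝ) :
    HasWeakGradient (c • u) (c • weakGrad u) :=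
  (hasWeakGradient_of_mem_homSobolev hu).const_smul c

theorem add_mem_homSobolev (hu : u ∈ homSobolev n p) (hv : v ∈ homSobolev n p) :
    u + v ∈ homSobolev n p :=
  mem_homSobolev (hu.1.add hv.1) (hasWeakGradient_add hu hv)
    ((memLp_weakGrad hu).add (memLp_weakGrad hv))

theorem smul_mem_homSobolev (hu : u ∈ homSobolev n p) (c : ℝ) : c • u ∈ homSobolev n p :=
  mem_homSobolev (hu.1.const_smul c) (hasWeakGradient_smul hu c) ((memLp_weakGrad hu).const_smul c)

theorem hasWeakGradient_sub_const (hu : u ∈ homSobolev n p) (c : ℝ) :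
    HasWeakGradient (fun x => u x - c) (weakGrad u) := by
  have := (hasWeakGradient_of_mem_homSobolev hu).add (hasWeakGradient_const (-c))
  rw [add_zero] at this
  exact this

end HomSobolev

/-! ### Local uniform bounds and closedness of the weak gradient -/

section LocalEstimate

variable {n : ℕ} {p q : ℝ}

theorem exists_average_estimate (hp : (n : ℝ) < p) (hpq : p.HolderConjugate q) :
    ∃ η : Rn n → ℝ, ContDiff ℝ ∞ η ∧ HasCompactSupport η ∧ ∫ y, η y = 1 ∧
      ∀ R : ℝ, ∃ C : ℝ, 0 ≤ C ∧ ∀ (u : Rn n → ℝ) (G : Rn n → Rn n), Continuous u →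
        HasWeakGradient u G → MemLp G (ENNReal.ofReal p) volume →
        ∀ x, ‖x‖ ≤ R → |u x - ∫ y, u y * η y| ≤ C * fieldNorm p G := by
  let B : ContDiffBump (0 : Rn n) := ⟨1, 2, one_pos, one_lt_two⟩
  have hs : ContDiff ℝ ∞ (B.normed volume) := B.contDiff_normed
  have hc : HasCompactSupport (B.normed volume) := B.hasCompactSupport_normed
  have hI : ∫ y, B.normed volume y = 1 := B.integral_normed
  refine ⟨B.normed volume, hs, hc, hI, fun R => ?_⟩
  set η := B.normed volume
  have hp0 := hpq.pos
  have hq0 := hpq.symm.pos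
  have hα : 0 < 1 - (n : ℝ) / p := by rw [sub_pos, div_lt_one hp0]; exact hp
  have hrpow : Continuous fun t : ℝ => t ^ q := Real.continuous_rpow_const hq0.le
  -- Replacing ‖w - x‖ by ‖w‖ + |R| in the kernel norm makes the constant independent of x in the
  -- ball.
  set D : ℝ := (∫ w, ‖η w‖ ^ q * (‖w‖ + |R|) ^ q) ^ (1 / q) with hD
  have hD0 : 0 ≤ D := Real.rpow_nonneg (integral_nonneg fun _ => by positivity) _
  have hi : Integrable fun w => ‖η w‖ ^ q * (‖w‖ + |R|) ^ q := by
    refine Continuous.integrable_of_hasCompactSupport ?_ ?_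
    · exact (hrpow.comp hs.continuous.norm).mul
        (hrpow.comp (by fun_prop : Continuous fun w : Rn n => ‖w‖ + |R|))
    · refine HasCompactSupport.mul_right ?_
      exact hc.comp_left (g := fun t => ‖t‖ ^ q) (by simp [hq0.ne'])
  refine ⟨D / (1 - n / p), by positivity, fun u G hu h hG x hx => ?_⟩
  have h1 := abs_mul_integral_sub_le hp hpq hu h hG hs hc x
  rw [hI, mul_one, abs_sub_comm] at h1
  refine h1.trans ?_
  rw [div_mul_eq_mul_div, mul_comm D]
  gcongr
  · exact fieldNorm_nonneg _ _
  · refine Real.rpow_le_rpow (integral_nonneg fun _ => by positivity) ?_ (by positivity)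
    refine integral_mono_of_nonneg (Eventually.of_forall fun _ => by positivity) hi
      (Eventually.of_forall fun w => ?_)
    simp only
    rw [norm_smul, Real.mul_rpow (norm_nonneg _) (norm_nonneg _)]
    have : ‖w - x‖ ≤ ‖w‖ + |R| :=
      (norm_sub_le _ _).trans (by gcongr; exact hx.trans (le_abs_self R))
    gcongr

theorem abs_integral_inner_mul_le (hpq : p.HolderConjugate q) {F : Rn n → Rn n}
    (hF : MemLp F (ENNReal.ofReal p) volume) {φ : Rn n → ℝ} (hφ : Continuous φ)
    (hc : HasCompactSupport φ) (w : Rn n) :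
    |∫ x, inner ℝ (F x) w * φ x| ≤ fieldNorm p F * fieldNorm q (fun x => φ x • w) := by
  have := abs_integral_inner_le hpq hF (G := fun x => φ x • w)
    (Continuous.memLp_of_hasCompactSupport (by fun_prop) hc.smul_right)
  simpa [inner_smul_right, mul_comm] using this

/-- Weak gradients of continuous functions are closed under `L^p` convergence. -/
theorem exists_hasWeakGradient_of_tendsto (hp : (n : ℝ) < p) (hpq : p.HolderConjugate q)
    {u : ℕ → Rn n → ℝ} (hu : ∀ k, u k ∈ homSobolev n p) {g : Rn n → Rn n}
    (hg : MemLp g (ENNReal.ofReal p) volume)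
    (hlim : Tendsto (fun k => fieldNorm p (weakGrad (u k) - g)) atTop (𝓝 0)) :
    ∃ v : Rn n → ℝ, Continuous v ∧ HasWeakGradient v g := by
  obtain ⟨η, hη, hηc, hI, hest⟩ := exists_average_estimate hp hpq
  have hp1 : 1 ≤ p := hpq.lt.le
  have hp0 : 0 < p := hpq.pos
  -- The gradients do not see additive constants, so the functions themselves may diverge; after
  -- subtracting their averages they are locally uniformly Cauchy.
  set w : ℕ → Rn n → ℝ := fun k x => u k x - ∫ y, u k y * η y with hw
  have hwc : ∀ k, Continuous (w k) := fun k => (hu k).1.sub continuous_const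
  have hwg : ∀ k, HasWeakGradient (w k) (weakGrad (u k)) := fun k =>
    hasWeakGradient_sub_const (hu k) _
  set e : ℕ → ℝ := fun k => fieldNorm p (weakGrad (u k) - g) with he
  have he0 : ∀ k, 0 ≤ e k := fun k => fieldNorm_nonneg _ _
  have hpair : ∀ R, ∃ C : ℝ, 0 ≤ C ∧ ∀ j k x, ‖x‖ ≤ R → |w j x - w k x| ≤ C * (e j + e k) := by
    intro R
    obtain ⟨C, hC0, hC⟩ := hest R
    refine ⟨C, hC0, fun j k x hx => ?_⟩
    have hmem := add_mem_homSobolev (hu j) (smul_mem_homSobolev (hu k) (-1))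
    have h1 := hC _ _ hmem.1 ((hasWeakGradient_of_mem_homSobolev (hu j)).add
      (hasWeakGradient_smul (hu k) (-1)))
      ((memLp_weakGrad (hu j)).add ((memLp_weakGrad (hu k)).const_smul (-1))) x hx
    have i1 := fun k => integrable_mul_of_hasCompactSupport (hu k).1.locallyIntegrable
      hη.continuous hηc
    have h2 : ∫ y, (u j + (-1 : ℝ) • u k) y * η y = (∫ y, u j y * η y) - ∫ y, u k y * η y := by
      rw [← integral_sub (i1 j) (i1 k)]
      congr 1
      funext y
      simp
      ring
    have h3 : (u j + (-1 : ℝ) • u k) x - ∫ y, (u j + (-1 : ℝ) • u k) y * η y =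
        w j x - w k x := by
      rw [h2]; simp [hw]; ring
    rw [h3] at h1
    refine h1.trans (mul_le_mul_of_nonneg_left ?_ hC0)
    have h4 : weakGrad (u j) + (-1 : ℝ) • weakGrad (u k) =
        (weakGrad (u j) - g) + (-1 : ℝ) • (weakGrad (u k) - g) := by
      rw [neg_one_smul, neg_one_smul]; abel
    rw [h4]
    refine (fieldNorm_add_le hp1 ((memLp_weakGrad (hu j)).sub hg)
      (((memLp_weakGrad (hu k)).sub hg).const_smul (-1))).trans_eq ?_
    rw [fieldNorm_smul hp0]
    simp [he]
  have hex : ∀ x, ∃ l, Tendsto (fun k => w k x) atTop (𝓝 l) := by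
    intro x
    obtain ⟨C, hC0, hC⟩ := hpair ‖x‖
    refine cauchySeq_tendsto_of_complete ?_
    rw [cauchySeq_iff_tendsto_dist_atTop_0]
    refine squeeze_zero (fun _ => dist_nonneg) (fun z => hC z.1 z.2 x le_rfl) ?_
    rw [← prod_atTop_atTop_eq]
    have : Tendsto (fun z : ℕ × ℕ => C * (e z.1 + e z.2)) (atTop ×ˢ atTop)
      (𝓝 (C * (0 + 0))) :=
      ((hlim.comp tendsto_fst).add (hlim.comp tendsto_snd)).const_mul C
    simpa using this
  choose v hv using hex
  have hdiff : ∀ R, ∃ C : ℝ, 0 ≤ C ∧ ∀ k x, ‖x‖ ≤ R → |w k x - v x| ≤ C * e k := by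
    intro R
    obtain ⟨C, hC0, hC⟩ := hpair R
    refine ⟨C, hC0, fun k x hx => ?_⟩
    have h1 : Tendsto (fun j => |w k x - w j x|) atTop (𝓝 |w k x - v x|) :=
      ((hv x).const_sub _).abs
    have h2 : Tendsto (fun j => C * (e k + e j)) atTop (𝓝 (C * (e k + 0))) :=
      (hlim.const_add _).const_mul C
    rw [add_zero] at h2
    exact le_of_tendsto_of_tendsto' h1 h2 fun j => hC k j x hx
  have hvc : Continuous v := by
    have : TendstoLocallyUniformly w v atTop := by
      rw [Metric.tendstoLocallyUniformly_iff]
      intro ε hε x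
      obtain ⟨C, hC0, hC⟩ := hdiff (‖x‖ + 1)
      refine ⟨ball x 1, ball_mem_nhds x one_pos, ?_⟩
      have h1 : Tendsto (fun k => C * e k) atTop (𝓝 0) := by simpa using hlim.const_mul C
      filter_upwards [h1.eventually_lt_const hε] with k hk y hy
      rw [dist_comm]
      refine (hC k y ?_).trans_lt hk
      have : ‖y - x‖ < 1 := by simpa [dist_eq_norm] using hy
      have := norm_le_norm_add_norm_sub' y x
      linarith
    exact this.continuous (Eventually.of_forall hwc).frequently
  refine ⟨v, hvc, .of_integral_fderiv_apply hvc.locallyIntegrable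
    (hg.locallyIntegrable (by simpa using hp1)) fun φ hφ hc z => ?_⟩
  have hd := continuous_fderiv_apply_const hφ z
  have hdc := hc.fderiv_apply ℝ z
  obtain ⟨R, hR⟩ := hdc.isCompact.isBounded.subset_closedBall (0 : Rn n)
  obtain ⟨C, hC0, hC⟩ := hdiff R
  set A : ℝ := C * (∫ x, |fderiv ℝ φ x z|) + fieldNorm q (fun x => φ x • z) with hA
  have hgl := locallyIntegrable_inner_const (hg.locallyIntegrable (by simpa using hp1)) z
  -- The integration by parts identity is exact for `w k`; passing to v and g costs at most a
  -- multiple of `e k` on each side.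
  have hbound : ∀ k, |(∫ x, v x * fderiv ℝ φ x z) + ∫ x, inner ℝ (g x) z * φ x| ≤ A * e k := by
    intro k
    have iw := integrable_mul_of_hasCompactSupport (hwc k).locallyIntegrable hd hdc
    have iv := integrable_mul_of_hasCompactSupport hvc.locallyIntegrable hd hdc
    have ig := integrable_mul_of_hasCompactSupport hgl hφ.continuous hc
    have iG := integrable_mul_of_hasCompactSupport
      (locallyIntegrable_inner_const (hwg k).locallyIntegrable_grad z) hφ.continuous hc
    have h1 := (hwg k).integral_fderiv_apply hφ hc z
    have h2 : |∫ x, (w k x * fderiv ℝ φ x z - v x * fderiv ℝ φ x z)| ≤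
        (C * e k) * ∫ x, |fderiv ℝ φ x z| := by
      rw [← integral_const_mul, ← Real.norm_eq_abs]
      refine norm_integral_le_of_norm_le
        ((hd.integrable_of_hasCompactSupport hdc).abs.const_mul _)
        (Eventually.of_forall fun x => ?_)
      rw [← sub_mul, norm_mul, Real.norm_eq_abs, Real.norm_eq_abs]
      by_cases hx : fderiv ℝ φ x z = 0
      · simp [hx]
      · refine mul_le_mul_of_nonneg_right (hC k x ?_) (abs_nonneg _)
        have := hR (subset_tsupport _ hx)
        simpa using this
    have h3 := abs_integral_inner_mul_le hpq ((memLp_weakGrad (hu k)).sub hg) hφ.continuous hc z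
    have h4 : ∫ x, inner ℝ ((weakGrad (u k) - g) x) z * φ x =
        (∫ x, inner ℝ (weakGrad (u k) x) z * φ x) - ∫ x, inner ℝ (g x) z * φ x := by
      rw [← integral_sub iG ig]
      congr 1
      funext x
      rw [Pi.sub_apply, inner_sub_left, sub_mul]
    rw [integral_sub iw iv] at h2
    rw [h4] at h3
    have h5 : (∫ x, v x * fderiv ℝ φ x z) + ∫ x, inner ℝ (g x) z * φ x =
        -((∫ x, w k x * fderiv ℝ φ x z) - ∫ x, v x * fderiv ℝ φ x z) -
        ((∫ x, inner ℝ (weakGrad (u k) x) z * φ x) - ∫ x, inner ℝ (g x) z * φ x) := by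
      rw [h1]; ring
    rw [h5]
    refine (abs_sub _ _).trans ?_
    rw [abs_neg, hA]
    calc _ ≤ C * e k * (∫ x, |fderiv ℝ φ x z|) + e k * fieldNorm q (fun x => φ x • z) :=
          add_le_add h2 h3
      _ = _ := by ring
  have hz : |(∫ x, v x * fderiv ℝ φ x z) + ∫ x, inner ℝ (g x) z * φ x| ≤ 0 := by
    have hA0 : Tendsto (fun k => A * e k) atTop (𝓝 0) := by simpa using hlim.const_mul A
    exact ge_of_tendsto' hA0 hbound
  have := abs_nonpos_iff.1 hz
  linarith

end LocalEstimate

/-! ### Integration against the signed measure -/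

section SignedIntegral

variable {n : ℕ} {ρ : SignedMeasure (Rn n)} {u v : Rn n → ℝ}

instance isFiniteMeasure_variation (ρ : SignedMeasure (Rn n)) :
    IsFiniteMeasure ρ.variation := by
  rw [← SignedMeasure.totalVariation_eq_variation]
  infer_instance

theorem Admissible.exists_radius (hρ : Admissible ρ) :
    ∃ R : ℝ, ∀ᵐ x ∂ρ.variation, ‖x‖ ≤ R := by
  obtain ⟨R, hR⟩ := hρ.isCompact_support.isBounded.subset_closedBall (0 : Rn n)
  refine ⟨R, ?_⟩
  have h := Measure.support_mem_ae (μ := ρ.totalVariation)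
  rw [SignedMeasure.totalVariation_eq_variation] at h hR
  filter_upwards [h] with x hx
  simpa using hR hx

theorem Admissible.integrable {E : Type*} [NormedAddCommGroup E] (hρ : Admissible ρ)
    {f : Rn n → E} (hf : Continuous f) : ρ.Integrable f := by
  obtain ⟨R, hR⟩ := hρ.exists_radius
  obtain ⟨C, hC⟩ := (isCompact_closedBall (0 : Rn n) R).exists_bound_of_continuousOn
    hf.continuousOn
  refine Integrable.of_bound hf.aestronglyMeasurable C ?_
  filter_upwards [hR] with x hx
  exact hC x (by simpa using hx)

/-- The Jordan decomposition transfers facts about ordinary Bochner integrals, such as commuting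
with continuous linear maps, to the signed measure. -/
theorem integral_eq_integral_sub_integral {E : Type*} [NormedAddCommGroup E] [NormedSpace ℝ E]
    {f : Rn n → E} (hf : ρ.Integrable f) :
    ∫ᵛ x, f x ∂<•ρ = (∫ x, f x ∂ρ.toJordanDecomposition.posPart) -
      ∫ x, f x ∂ρ.toJordanDecomposition.negPart := by
  have hv : ρ.variation =
      ρ.toJordanDecomposition.posPart + ρ.toJordanDecomposition.negPart := by
    rw [← SignedMeasure.totalVariation_eq_variation, SignedMeasure.totalVariation]
  have h1 : ρ = ρ.toJordanDecomposition.posPart.toSignedMeasure -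
      ρ.toJordanDecomposition.negPart.toSignedMeasure :=
    (SignedMeasure.toSignedMeasure_toJordanDecomposition ρ).symm
  have hf' : Integrable f ρ.variation := hf
  rw [hv] at hf'
  rw [← VectorMeasure.integral_toSignedMeasure, ← VectorMeasure.integral_toSignedMeasure,
    ← VectorMeasure.integral_sub_vectorMeasure, ← h1]
  · simpa [VectorMeasure.Integrable] using hf'.left_of_add_measure
  · simpa [VectorMeasure.Integrable] using hf'.right_of_add_measure

theorem Admissible.integral_clm_apply {E F : Type*} [NormedAddCommGroup E] [NormedSpace ℝ E]
    [CompleteSpace E] [NormedAddCommGroup F] [NormedSpace ℝ F] [CompleteSpace F]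
    (hρ : Admissible ρ) {f : Rn n → E} (hf : Continuous f) (L : E →L[ℝ] F) :
    ∫ᵛ x, L (f x) ∂<•ρ = L (∫ᵛ x, f x ∂<•ρ) := by
  have hi : Integrable f ρ.variation := hρ.integrable hf
  rw [← SignedMeasure.totalVariation_eq_variation, SignedMeasure.totalVariation] at hi
  rw [integral_eq_integral_sub_integral (hρ.integrable hf),
    integral_eq_integral_sub_integral (f := fun x => L (f x))
      (hρ.integrable (L.continuous.comp hf)),
    L.integral_comp_comm hi.left_of_add_measure, L.integral_comp_comm hi.right_of_add_measure,
    map_sub]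

theorem sInt_add (hρ : Admissible ρ) (hu : Continuous u) (hv : Continuous v) :
    sInt ρ (u + v) = sInt ρ u + sInt ρ v :=
  VectorMeasure.integral_add (hρ.integrable hu) (hρ.integrable hv)

theorem sInt_smul (c : ℝ) (u : Rn n → ℝ) : sInt ρ (c • u) = c * sInt ρ u :=
  VectorMeasure.integral_smul u ρ _ c

theorem sInt_const (hρ : Admissible ρ) (c : ℝ) : sInt ρ (fun _ => c) = 0 := by
  unfold sInt
  rw [VectorMeasure.integral_const]
  simp [hρ.mass_zero]

theorem sInt_sub_const (hρ : Admissible ρ) (hu : Continuous u) (c : ℝ) :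
    sInt ρ (fun x => u x - c) = sInt ρ u := by
  have := sInt_add hρ hu (continuous_const (y := -c))
  rw [sInt_const hρ, add_zero] at this
  rw [← this]
  rfl

/-- Mass zero allows the average of u to be subtracted; Morrey's estimate then bounds the integrand
on a ball carrying ρ. -/
theorem exists_abs_sInt_le {p q : ℝ} (hp : (n : ℝ) < p) (hpq : p.HolderConjugate q)
    (hρ : Admissible ρ) : ∃ K : ℝ, 0 ≤ K ∧ ∀ u ∈ homSobolev n p,
      |sInt ρ u| ≤ K * fieldNorm p (weakGrad u) := by
  obtain ⟨R, hR⟩ := hρ.exists_radius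
  obtain ⟨η, -, -, -, hest⟩ := exists_average_estimate hp hpq
  obtain ⟨C, hC0, hC⟩ := hest R
  refine ⟨C * ‖(ContinuousLinearMap.lsmul ℝ ℝ : ℝ →L[ℝ] ℝ →L[ℝ] ℝ).flip‖ *
    ρ.variation.real univ, by positivity, fun u hu => ?_⟩
  rw [← sInt_sub_const hρ hu.1 (∫ y, u y * η y)]
  have h := VectorMeasure.norm_integral_le_of_norm_le_const (μ := ρ)
    (B := (ContinuousLinearMap.lsmul ℝ ℝ : ℝ →L[ℝ] ℝ →L[ℝ] ℝ).flip)
    (f := fun x => u x - ∫ y, u y * η y) (C := C * fieldNorm p (weakGrad u)) (by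
      filter_upwards [hR] with x hx
      exact hC u _ hu.1 (hasWeakGradient_of_mem_homSobolev hu) (memLp_weakGrad hu) x hx)
  refine h.trans_eq ?_
  ring

end SignedIntegral

/-! ### The primal problem -/

section Primal

variable {n : ℕ} {p q : ℝ} {ρ : SignedMeasure (Rn n)}

theorem bddAbove_primalValues (hp : (n : ℝ) < p) (hpq : p.HolderConjugate q)
    (hρ : Admissible ρ) : BddAbove (primalValues p ρ) := by
  obtain ⟨K, hK0, hK⟩ := exists_abs_sInt_le hp hpq hρ
  refine ⟨K, ?_⟩
  rintro t ⟨u, hu, hu1, rfl⟩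
  exact (hK u hu).trans (mul_le_of_le_one_right hK0 hu1)

theorem abs_sInt_le (hp : (n : ℝ) < p) (hpq : p.HolderConjugate q)
    (hρ : Admissible ρ) {u : Rn n → ℝ} (hu : u ∈ homSobolev n p) :
    |sInt ρ u| ≤ sSup (primalValues p ρ) * fieldNorm p (weakGrad u) := by
  obtain ⟨K, hK0, hK⟩ := exists_abs_sInt_le hp hpq hρ
  -- A function with zero gradient cannot be normalized; the a priori bound with constant K settles
  -- that case.
  rcases (fieldNorm_nonneg p (weakGrad u)).eq_or_lt with h0 | h0
  · have := hK u hu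
    rw [← h0, mul_zero] at this ⊢
    exact this
  · set N := fieldNorm p (weakGrad u)
    have hmem := smul_mem_homSobolev hu N⁻¹
    have hN : fieldNorm p (weakGrad (N⁻¹ • u)) = 1 := by
      rw [fieldNorm_weakGrad (hasWeakGradient_smul hu _), fieldNorm_smul hpq.pos,
        abs_of_pos (inv_pos.2 h0), inv_mul_cancel₀ h0.ne']
    have := le_csSup (bddAbove_primalValues hp hpq hρ) ⟨_, hmem, hN.le, rfl⟩
    rwa [sInt_smul, abs_mul, abs_of_pos (inv_pos.2 h0), inv_mul_le_iff₀ h0, mul_comm] at this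

theorem primalValues_sSup_pos (hp : (n : ℝ) < p) (hpq : p.HolderConjugate q)
    (hρ : Admissible ρ) : 0 < sSup (primalValues p ρ) := by
  obtain ⟨R, hR⟩ := hρ.exists_radius
  let B : ContDiffBump (0 : Rn n) := ⟨max R 1, max R 1 + 1, by positivity, by linarith⟩
  set m := firstMoment ρ with hm
  -- The cut-off equals 1 on a ball carrying ρ, so this function has integral ⟨m, m⟩ > 0.
  set u : Rn n → ℝ := fun x => B x * inner ℝ m x with hu
  have hus : ContDiff ℝ ∞ u := B.contDiff.mul (contDiff_const.inner ℝ contDiff_id)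
  have huc : HasCompactSupport u := B.hasCompactSupport.mul_right
  have hgc : Continuous (fun x => gradient u x) := by
    unfold gradient
    exact (LinearIsometryEquiv.continuous _).comp (hus.continuous_fderiv (by simp))
  have hgs : HasCompactSupport (fun x => gradient u x) := by
    unfold gradient
    exact (huc.fderiv (𝕜 := ℝ)).comp_left (map_zero _)
  have hmem : u ∈ homSobolev n p := mem_homSobolev hus.continuous (hasWeakGradient_of_contDiff hus)
    (hgc.memLp_of_hasCompactSupport hgs)
  have hval : sInt ρ u = ‖m‖ ^ 2 := by
    have h1 : sInt ρ u = sInt ρ (fun x => inner ℝ m x) := by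
      refine VectorMeasure.integral_congr_ae ?_
      filter_upwards [hR] with x hx
      have hxB : ‖x‖ ≤ B.rIn := hx.trans (le_max_left R 1)
      have : B x = 1 := B.one_of_mem_closedBall (by simpa using hxB)
      simp [hu, this]
    rw [h1, ← real_inner_self_eq_norm_sq]
    exact hρ.integral_clm_apply continuous_id (innerSL ℝ m)
  have hm0 : 0 < ‖m‖ := norm_pos_iff.2 hρ.firstMoment_ne_zero
  have h := abs_sInt_le hp hpq hρ hmem
  rw [hval, abs_of_pos (by positivity)] at h
  by_contra hneg
  push Not at hneg
  have := mul_nonpos_of_nonpos_of_nonneg hneg (fieldNorm_nonneg p (weakGrad u))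
  have : 0 < ‖m‖ ^ 2 := by positivity
  linarith

/-- The supremum defining the primal problem is attained. -/
theorem exists_maximizer (hp : (n : ℝ) < p) (hpq : p.HolderConjugate q)
    (hρ : Admissible ρ) : ∃ v ∈ homSobolev n p, fieldNorm p (weakGrad v) = 1 ∧
      sInt ρ v = sSup (primalValues p ρ) := by
  set M := sSup (primalValues p ρ) with hM
  have hM0 : 0 < M := primalValues_sSup_pos hp hpq hρ
  have hp0 := hpq.pos
  have hne : (primalValues p ρ).Nonempty := by
    by_contra h
    rw [not_nonempty_iff_eq_empty] at h
    simp [hM, h] at hM0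
  obtain ⟨t, -, htend, htmem⟩ :=
    exists_seq_tendsto_sSup hne (bddAbove_primalValues hp hpq hρ)
  have hseq : ∀ k, ∃ u ∈ homSobolev n p, fieldNorm p (weakGrad u) ≤ 1 ∧ sInt ρ u = t k := by
    intro k
    obtain ⟨u, hu, hu1, hut⟩ := htmem k
    rcases abs_choice (sInt ρ u) with h | h
    · exact ⟨u, hu, hu1, by rw [hut, h]⟩
    · refine ⟨(-1 : ℝ) • u, smul_mem_homSobolev hu _, ?_, by rw [sInt_smul, hut, h]; ring⟩
      rw [fieldNorm_weakGrad (hasWeakGradient_smul hu _), fieldNorm_smul hp0]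
      simpa using hu1
  choose u hu hu1 hut using hseq
  have hlu : Tendsto (fun k => sInt ρ (u k)) atTop (𝓝 M) := by
    simpa only [hut] using htend
  have : Fact ((1 : ℝ≥0∞) ≤ ENNReal.ofReal p) := ⟨by simpa using hpq.lt.le⟩
  set g : ℕ → Lp (Rn n) (ENNReal.ofReal p) volume := fun k =>
    (memLp_weakGrad (hu k)).toLp (weakGrad (u k)) with hg
  have hcauchy : CauchySeq g := by
    rw [cauchySeq_iff_tendsto_dist_atTop_0, Metric.tendsto_nhds]
    intro ε hε
    obtain ⟨C, hC0, hC⟩ := exists_fieldNorm_sub_rpow_le n hpq.lt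
      (by positivity : 0 < ε ^ p / 4)
    -- A lower bound for the p-th power of the gradient norm of the midpoint; it tends to 1 along a
    -- maximizing sequence.
    set r : ℕ × ℕ → ℝ := fun z => |(2⁻¹ * (sInt ρ (u z.1) + sInt ρ (u z.2))) / M| ^ p with hr
    have hrlim : Tendsto (fun z => C * (1 - r z)) atTop (𝓝 0) := by
      have h1 : Tendsto (fun z : ℕ × ℕ => (2⁻¹ * (sInt ρ (u z.1) + sInt ρ (u z.2))) / M) atTop
          (𝓝 ((2⁻¹ * (M + M)) / M)) := by
        rw [← prod_atTop_atTop_eq]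
        exact (((hlu.comp tendsto_fst).add (hlu.comp tendsto_snd)).const_mul _).div_const M
      have h2 : (2⁻¹ * (M + M)) / M = 1 := by field_simp; norm_num
      rw [h2] at h1
      have h3 := (((h1.abs.rpow_const (p := p) (Or.inr hp0.le)).const_sub 1).const_mul C)
      simpa using h3
    filter_upwards [hrlim.eventually_lt_const (by positivity : 0 < ε ^ p / 2)] with z hz
    rw [Real.dist_0_eq_abs, abs_of_nonneg dist_nonneg, dist_eq_norm]
    have hm1 := memLp_weakGrad (hu z.1)
    have hm2 := memLp_weakGrad (hu z.2)
    have h1 : ‖g z.1 - g z.2‖ = fieldNorm p (weakGrad (u z.1) - weakGrad (u z.2)) := by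
      rw [fieldNorm_eq_norm_toLp hp0 (hm1.sub hm2), MemLp.toLp_sub]
    have h2 := hC _ _ hm1 hm2
    have hmid := smul_mem_homSobolev (add_mem_homSobolev (hu z.1) (hu z.2)) (2⁻¹ : ℝ)
    have h3 := abs_sInt_le hp hpq hρ hmid
    rw [fieldNorm_weakGrad ((hasWeakGradient_add (hu z.1) (hu z.2)).const_smul _), sInt_smul,
      sInt_add hρ (hu z.1).1 (hu z.2).1] at h3
    have h4 : r z ≤ fieldNorm p ((2⁻¹ : ℝ) • (weakGrad (u z.1) + weakGrad (u z.2))) ^ p := by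
      refine Real.rpow_le_rpow (abs_nonneg _) ?_ hp0.le
      rw [abs_div, abs_of_pos hM0, div_le_iff₀' hM0]
      exact h3
    have h5 : ∀ k, fieldNorm p (weakGrad (u k)) ^ p ≤ 1 := fun k =>
      Real.rpow_le_one (fieldNorm_nonneg _ _) (hu1 k) hp0.le
    rw [h1, ← Real.rpow_lt_rpow_iff (fieldNorm_nonneg _ _) hε.le hp0]
    have hε4 : 0 < ε ^ p / 4 := by positivity
    have h6 : (ε ^ p / 4) * (fieldNorm p (weakGrad (u z.1)) ^ p +
        fieldNorm p (weakGrad (u z.2)) ^ p) ≤ (ε ^ p / 4) * 2 :=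
      mul_le_mul_of_nonneg_left (by linarith [h5 z.1, h5 z.2]) hε4.le
    have h7 : C * ((fieldNorm p (weakGrad (u z.1)) ^ p + fieldNorm p (weakGrad (u z.2)) ^ p) / 2 -
        fieldNorm p ((2⁻¹ : ℝ) • (weakGrad (u z.1) + weakGrad (u z.2))) ^ p) ≤ C * (1 - r z) :=
      mul_le_mul_of_nonneg_left (by linarith [h5 z.1, h5 z.2]) hC0
    linarith
  obtain ⟨G, hG⟩ := cauchySeq_tendsto_of_complete hcauchy
  have hGm : MemLp G (ENNReal.ofReal p) volume := Lp.memLp G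
  have hconv : Tendsto (fun k => fieldNorm p (weakGrad (u k) - ⇑G)) atTop (𝓝 0) := by
    have h1 : ∀ k, fieldNorm p (weakGrad (u k) - ⇑G) = ‖g k - G‖ := by
      intro k
      rw [fieldNorm_eq_norm_toLp hp0 ((memLp_weakGrad (hu k)).sub hGm), MemLp.toLp_sub _ hGm,
        Lp.toLp_coeFn]
    simp only [h1]
    exact tendsto_iff_norm_sub_tendsto_zero.1 hG
  obtain ⟨v, hvc, hvG⟩ := exists_hasWeakGradient_of_tendsto hp hpq hu hGm hconv
  have hv : v ∈ homSobolev n p := mem_homSobolev hvc hvG hGm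
  have hlv : sInt ρ v = M := by
    refine tendsto_nhds_unique ?_ hlu
    rw [tendsto_iff_norm_sub_tendsto_zero]
    refine squeeze_zero (fun _ => norm_nonneg _) (fun k => ?_)
      (by simpa using hconv.const_mul M)
    have h1 := add_mem_homSobolev (hu k) (smul_mem_homSobolev hv (-1))
    have h2 := abs_sInt_le hp hpq hρ h1
    rw [sInt_add hρ (hu k).1 (hv.1.const_smul _), sInt_smul, neg_one_mul, ← sub_eq_add_neg] at h2
    refine h2.trans_eq ?_
    rw [fieldNorm_weakGrad ((hasWeakGradient_of_mem_homSobolev (hu k)).add (hvG.const_smul (-1))),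
      neg_one_smul, ← sub_eq_add_neg]
  -- The norm is at most 1 as a limit of such norms, and at least 1 because M = ∫ v dρ ≤ M ‖Dv‖_p
  -- with M > 0.
  refine ⟨v, hv, le_antisymm ?_ ?_, hlv⟩
  · rw [fieldNorm_weakGrad hvG, fieldNorm_eq_norm_toLp hp0 hGm, Lp.toLp_coeFn]
    refine le_of_tendsto' hG.norm fun k => ?_
    rw [← fieldNorm_eq_norm_toLp hp0]
    exact hu1 k
  · have := abs_sInt_le hp hpq hρ hv
    rw [hlv, abs_of_pos hM0] at this
    exact le_of_mul_le_mul_left (by simpa using this) hM0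

end Primal

/-! ### The Euler–Lagrange equation and the dual field -/

section EulerLagrange

variable {n : ℕ} {p q : ℝ} {ρ : SignedMeasure (Rn n)}

theorem rpow_sub_two_mul_self (hp : 1 < p) {a : ℝ} (ha : 0 ≤ a) : a ^ (p - 2) * a = a ^ (p - 1) := by
  -- The exponent p - 2 may be negative or zero, so a = 0 is treated apart.
  rcases ha.eq_or_lt with rfl | ha
  · rw [mul_zero, Real.zero_rpow (by linarith)]
  · rw [← Real.rpow_add_one ha.ne']
    ring_nf

/-- For |s| < 1 the derivative of the integrand is dominated by p (|F| + |G|)^p, which justifies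
differentiating under the integral. -/
theorem hasDerivAt_integral_norm_rpow (hp : 1 < p) {F G : Rn n → Rn n}
    (hF : MemLp F (ENNReal.ofReal p) volume) (hG : MemLp G (ENNReal.ofReal p) volume) :
    HasDerivAt (fun s : ℝ => ∫ x, ‖F x + s • G x‖ ^ p)
      (∫ x, p * ‖F x‖ ^ (p - 2) * inner ℝ (F x) (G x)) 0 := by
  have hp0 : 0 < p := by linarith
  have hbi : Integrable fun x => p * (‖F x‖ + ‖G x‖) ^ p := by
    have h := (hF.norm.add hG.norm).integrable_norm_rpow (by simpa using hp0) (by simp)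
    rw [ENNReal.toReal_ofReal hp0.le] at h
    refine (h.congr (Eventually.of_forall fun x => ?_)).const_mul p
    simp only [Pi.add_apply]
    rw [Real.norm_of_nonneg (by positivity)]
  have hi : ∀ s : ℝ, Integrable fun x => ‖F x + s • G x‖ ^ p := fun s =>
    integrable_norm_rpow hp0 (hF.add (hG.const_smul s))
  have key := (hasDerivAt_integral_of_dominated_loc_of_deriv_le (μ := volume) (x₀ := (0 : ℝ))
    (s := ball 0 1)
    (F := fun s x => ‖F x + s • G x‖ ^ p)
    (F' := fun s x => p * ‖F x + s • G x‖ ^ (p - 2) * inner ℝ (F x + s • G x) (G x))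
    (ball_mem_nhds _ one_pos) (Eventually.of_forall fun s => (hi s).aestronglyMeasurable)
    (hi 0) ?_ ?_ hbi ?_).2
  · simpa using key
  · simp only [zero_smul, add_zero]
    exact ((hF.1.norm.aemeasurable.pow_const _).aestronglyMeasurable.const_mul p).mul
      (hF.1.inner hG.1)
  · refine Eventually.of_forall fun x s hs => ?_
    have hs1 : |s| ≤ 1 := by
      have : |s| < 1 := by simpa using hs
      exact this.le
    set y := F x + s • G x
    have hy : ‖y‖ ≤ ‖F x‖ + ‖G x‖ := by
      refine (norm_add_le _ _).trans ?_
      rw [norm_smul, Real.norm_eq_abs]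
      gcongr
      exact mul_le_of_le_one_left (norm_nonneg _) hs1
    rw [mul_assoc, norm_mul, Real.norm_of_nonneg hp0.le, norm_mul,
      Real.norm_of_nonneg (by positivity : 0 ≤ ‖y‖ ^ (p - 2))]
    refine mul_le_mul_of_nonneg_left ?_ hp0.le
    calc ‖y‖ ^ (p - 2) * ‖inner ℝ y (G x)‖ ≤ ‖y‖ ^ (p - 2) * (‖y‖ * ‖G x‖) := by
          gcongr
          exact norm_inner_le_norm _ _
      _ = ‖y‖ ^ (p - 1) * ‖G x‖ := by
          rw [← mul_assoc, rpow_sub_two_mul_self hp (norm_nonneg _)]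
      _ ≤ (‖F x‖ + ‖G x‖) ^ (p - 1) * (‖F x‖ + ‖G x‖) := by
          have h1 : 0 ≤ p - 1 := by linarith
          gcongr
          exact le_add_of_nonneg_left (norm_nonneg _)
      _ = (‖F x‖ + ‖G x‖) ^ p := by
          rw [← Real.rpow_add_one' (by positivity) (by linarith)]
          ring_nf
  · refine Eventually.of_forall fun x s _ => ?_
    have h1 : HasDerivAt (fun s : ℝ => F x + s • G x) (G x) s := by
      simpa using ((hasDerivAt_id s).smul_const (G x)).const_add (F x)
    have h2 := (hasFDerivAt_norm_rpow (F x + s • G x) hp).comp_hasDerivAt s h1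
    exact h2

theorem sInt_eq_integral_of_maximizer (hp : (n : ℝ) < p) (hpq : p.HolderConjugate q)
    (hρ : Admissible ρ) {v w : Rn n → ℝ} (hv : v ∈ homSobolev n p)
    (hv1 : fieldNorm p (weakGrad v) = 1) (hvM : sInt ρ v = sSup (primalValues p ρ))
    (hw : w ∈ homSobolev n p) :
    sInt ρ w = sSup (primalValues p ρ) *
      ∫ x, ‖weakGrad v x‖ ^ (p - 2) * inner ℝ (weakGrad v x) (weakGrad w x) := by
  set M := sSup (primalValues p ρ)
  have hM0 : 0 < M := primalValues_sSup_pos hp hpq hρ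
  have hp0 := hpq.pos
  have hd := hasDerivAt_integral_norm_rpow hpq.lt (memLp_weakGrad hv) (memLp_weakGrad hw)
  have hlin : HasDerivAt (fun s : ℝ => M + s * sInt ρ w) (sInt ρ w) 0 := by
    simpa using ((hasDerivAt_id (0 : ℝ)).mul_const (sInt ρ w)).const_add M
  have hpow := hlin.rpow_const (p := p) (Or.inl (by simpa using hM0.ne'))
  -- The function vanishes at 0, and is nonnegative nearby by the p-th power of `abs_sInt_le` for v
  -- + s w. Working with p-th powers avoids differentiating a p-th root.
  have hmin : IsLocalMin (fun s : ℝ => M ^ p * (∫ x, ‖weakGrad v x + s • weakGrad w x‖ ^ p) -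
      (M + s * sInt ρ w) ^ p) 0 := by
    have hpos : ∀ᶠ s : ℝ in 𝓝 0, 0 < M + s * sInt ρ w :=
      hlin.continuousAt.eventually (lt_mem_nhds (by simpa using hM0))
    filter_upwards [hpos] with s hs
    have h0 : ∫ x, ‖weakGrad v x + (0 : ℝ) • weakGrad w x‖ ^ p = 1 := by
      simp only [zero_smul, add_zero]
      rw [← fieldNorm_rpow hp0, hv1, Real.one_rpow]
    rw [h0]
    have h1 := abs_sInt_le hp hpq hρ (add_mem_homSobolev hv (smul_mem_homSobolev hw s))
    rw [sInt_add hρ hv.1 (hw.1.const_smul s), sInt_smul, hvM, abs_of_pos hs,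
      fieldNorm_weakGrad ((hasWeakGradient_of_mem_homSobolev hv).add
        (hasWeakGradient_smul hw s))] at h1
    have h2 := Real.rpow_le_rpow hs.le h1 hp0.le
    rw [Real.mul_rpow hM0.le (fieldNorm_nonneg _ _), fieldNorm_rpow hp0] at h2
    simp only [zero_mul, add_zero, mul_one, sub_self, sub_nonneg]
    exact h2
  have hzero := hmin.hasDerivAt_eq_zero ((hd.const_mul (M ^ p)).sub hpow)
  have hI : ∫ x, p * ‖weakGrad v x‖ ^ (p - 2) * inner ℝ (weakGrad v x) (weakGrad w x) =
      p * ∫ x, ‖weakGrad v x‖ ^ (p - 2) * inner ℝ (weakGrad v x) (weakGrad w x) := by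
    rw [← integral_const_mul]
    simp only [mul_assoc]
  rw [hI] at hzero
  simp only [zero_mul, add_zero] at hzero
  have hMp : M ^ p = M ^ (p - 1) * M := by
    rw [← Real.rpow_add_one hM0.ne']
    ring_nf
  rw [hMp] at hzero
  have hc : 0 < p * M ^ (p - 1) := by positivity
  refine mul_left_cancel₀ hc.ne' ?_
  linarith

theorem norm_rpow_sub_two_smul (hp : 1 < p) (a : Rn n) : ‖‖a‖ ^ (p - 2) • a‖ = ‖a‖ ^ (p - 1) := by
  rw [norm_smul, Real.norm_of_nonneg (by positivity), rpow_sub_two_mul_self hp (norm_nonneg _)]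

theorem norm_rpow_sub_two_smul_rpow (hpq : p.HolderConjugate q) (a : Rn n) :
    ‖‖a‖ ^ (p - 2) • a‖ ^ q = ‖a‖ ^ p := by
  rw [norm_rpow_sub_two_smul hpq.lt, ← Real.rpow_mul (norm_nonneg _), hpq.sub_one_mul_conj]

theorem memLp_norm_rpow_sub_two_smul (hpq : p.HolderConjugate q) {F : Rn n → Rn n}
    (hF : MemLp F (ENNReal.ofReal p) volume) :
    MemLp (fun x => ‖F x‖ ^ (p - 2) • F x) (ENNReal.ofReal q) volume := by
  have hq0 := hpq.symm.pos
  have hm : AEStronglyMeasurable (fun x => ‖F x‖ ^ (p - 2) • F x) volume :=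
    (hF.1.norm.aemeasurable.pow_const _).aestronglyMeasurable.smul hF.1
  rw [← integrable_norm_rpow_iff hm (by simpa using hq0) (by simp), ENNReal.toReal_ofReal hq0.le]
  simp only [norm_rpow_sub_two_smul_rpow hpq]
  exact integrable_norm_rpow hpq.pos hF

theorem fieldNorm_norm_rpow_sub_two_smul (hpq : p.HolderConjugate q) {F : Rn n → Rn n}
    (hF : fieldNorm p F = 1) : fieldNorm q (fun x => ‖F x‖ ^ (p - 2) • F x) = 1 := by
  have h := fieldNorm_rpow hpq.pos F
  rw [hF, Real.one_rpow] at h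
  unfold fieldNorm
  simp only [norm_rpow_sub_two_smul_rpow hpq]
  rw [← h, Real.one_rpow]

end EulerLagrange

/-! ### Weak duality and attainment -/

section Duality

variable {n : ℕ} {p q : ℝ} {ρ : SignedMeasure (Rn n)}

theorem sSup_primalValues_le_of_mem_dualValues (hp : (n : ℝ) < p) (hpq : p.HolderConjugate q)
    (hρ : Admissible ρ) {t : ℝ} (ht : t ∈ dualValues p q ρ) : sSup (primalValues p ρ) ≤ t := by
  obtain ⟨F, ⟨hF, hdiv⟩, rfl⟩ := ht
  obtain ⟨v, hv, hv1, hvM⟩ := exists_maximizer hp hpq hρ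
  rw [← hvM, ← hdiv v hv]
  have := abs_integral_inner_le hpq (memLp_weakGrad hv) hF
  rw [hv1, one_mul] at this
  exact (neg_le_abs _).trans this

theorem mem_dualFields_of_maximizer (hp : (n : ℝ) < p) (hpq : p.HolderConjugate q)
    (hρ : Admissible ρ) {v : Rn n → ℝ} (hv : v ∈ homSobolev n p)
    (hv1 : fieldNorm p (weakGrad v) = 1) (hvM : sInt ρ v = sSup (primalValues p ρ)) :
    (fun x => -(sSup (primalValues p ρ) • (‖weakGrad v x‖ ^ (p - 2) • weakGrad v x))) ∈
      dualFields p q ρ := by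
  refine ⟨((memLp_norm_rpow_sub_two_smul hpq (memLp_weakGrad hv)).const_smul
    (sSup (primalValues p ρ))).neg, fun w hw => ?_⟩
  rw [sInt_eq_integral_of_maximizer hp hpq hρ hv hv1 hvM hw, ← integral_const_mul, ← integral_neg]
  congr 1
  funext x
  rw [inner_neg_right, neg_neg, inner_smul_right, inner_smul_right, real_inner_comm]

theorem fieldNorm_dual_of_maximizer (hp : (n : ℝ) < p) (hpq : p.HolderConjugate q)
    (hρ : Admissible ρ) {v : Rn n → ℝ} (hv1 : fieldNorm p (weakGrad v) = 1) :
    fieldNorm q (fun x =>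
      -(sSup (primalValues p ρ) • (‖weakGrad v x‖ ^ (p - 2) • weakGrad v x))) =
      sSup (primalValues p ρ) := by
  have h : (fun x => -(sSup (primalValues p ρ) • (‖weakGrad v x‖ ^ (p - 2) • weakGrad v x))) =
      (-sSup (primalValues p ρ)) • fun x => ‖weakGrad v x‖ ^ (p - 2) • weakGrad v x := by
    funext x
    simp
  rw [h, fieldNorm_smul hpq.symm.pos, fieldNorm_norm_rpow_sub_two_smul hpq hv1, mul_one, abs_neg,
    abs_of_pos (primalValues_sSup_pos hp hpq hρ)]

theorem sInf_dualValues (hp : (n : ℝ) < p) (hpq : p.HolderConjugate q) (hρ : Admissible ρ) :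
    sSup (primalValues p ρ) = sInf (dualValues p q ρ) := by
  obtain ⟨v, hv, hv1, hvM⟩ := exists_maximizer hp hpq hρ
  have hleast : IsLeast (dualValues p q ρ) (sSup (primalValues p ρ)) :=
    ⟨⟨_, mem_dualFields_of_maximizer hp hpq hρ hv hv1 hvM,
      fieldNorm_dual_of_maximizer hp hpq hρ hv1⟩,
      fun _ ht => sSup_primalValues_le_of_mem_dualValues hp hpq hρ ht⟩
  exact hleast.csInf_eq.symm

end Duality

/-! ### Behaviour under similarities -/

section Similarity

variable {n : ℕ} {p q : ℝ} {ρ : SignedMeasure (Rn n)} {l : ℝ}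

/-- The similarity `y ↦ λ O y + z` as a homeomorphism. -/
noncomputable def similarityHomeomorph (hl : 0 < l) (O : Rn n ≃ₗᵢ[ℝ] Rn n) (z : Rn n) :
    Rn n ≃ₜ Rn n :=
  O.toHomeomorph.trans ((Homeomorph.smulOfNeZero l hl.ne').trans (Homeomorph.addRight z))

theorem coe_similarityHomeomorph (hl : 0 < l) (O : Rn n ≃ₗᵢ[ℝ] Rn n) (z : Rn n) :
    ⇑(similarityHomeomorph hl O z) = similarity l O z := rfl

theorem similarityHomeomorph_symm_apply (hl : 0 < l) (O : Rn n ≃ₗᵢ[ℝ] Rn n) (z x : Rn n) :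
    (similarityHomeomorph hl O z).symm x = O.symm (l⁻¹ • (x - z)) := by
  rw [Homeomorph.symm_apply_eq, coe_similarityHomeomorph]
  simp [similarity, smul_smul, hl.ne']

theorem map_similarity_volume (hl : 0 < l) (O : Rn n ≃ₗᵢ[ℝ] Rn n) (z : Rn n) :
    Measure.map (similarity l O z) volume = ENNReal.ofReal ((l ^ n)⁻¹) • volume := by
  have h : similarity l O z = (fun x => x + z) ∘ (fun x => l • x) ∘ O := rfl
  rw [h, ← Measure.map_map (by fun_prop) (by fun_prop), ← Measure.map_map (by fun_prop)
    (by fun_prop), (LinearIsometryEquiv.measurePreserving O).map_eq,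
    Measure.map_addHaar_smul _ hl.ne', Measure.map_smul, map_add_right_eq_self]
  rw [abs_of_pos (by positivity)]
  simp

theorem integral_comp_similarity (hl : 0 < l) (O : Rn n ≃ₗᵢ[ℝ] Rn n) (z : Rn n) (f : Rn n → ℝ) :
    ∫ y, f (similarity l O z y) = (l ^ n)⁻¹ * ∫ x, f x := by
  have h := (similarityHomeomorph hl O z).measurableEmbedding.integral_map (μ := volume) f
  rw [coe_similarityHomeomorph, map_similarity_volume hl, integral_smul_measure,
    ENNReal.toReal_ofReal (by positivity)] at h
  exact h.symm

theorem memLp_comp_similarity (hl : 0 < l) (O : Rn n ≃ₗᵢ[ℝ] Rn n) (z : Rn n) {r : ℝ≥0∞}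
    {G : Rn n → Rn n} (hG : MemLp G r volume) :
    MemLp (fun y => l • O.symm (G (similarity l O z y))) r volume := by
  have h : MemLp (G ∘ similarity l O z) r volume := by
    refine MemLp.comp_of_map ?_ (similarityHomeomorph hl O z).continuous.measurable.aemeasurable
    rw [map_similarity_volume hl]
    exact hG.smul_measure ENNReal.ofReal_ne_top
  exact ((O.symm.toContinuousLinearEquiv : Rn n →L[ℝ] Rn n).comp_memLp' h).const_smul l

theorem fieldNorm_comp_similarity (hp : 0 < p) (hl : 0 < l) (O : Rn n ≃ₗᵢ[ℝ] Rn n) (z : Rn n)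
    (G : Rn n → Rn n) : fieldNorm p (fun y => l • O.symm (G (similarity l O z y))) =
      l ^ (1 - (n : ℝ) / p) * fieldNorm p G := by
  have h := fieldNorm_smul hp l (fun y => O.symm (G (similarity l O z y)))
  rw [abs_of_pos hl] at h
  refine h.trans ?_
  unfold fieldNorm
  simp only [LinearIsometryEquiv.norm_map]
  rw [integral_comp_similarity hl O z (fun x => ‖G x‖ ^ p),
    Real.mul_rpow (by positivity) (integral_nonneg fun _ => by positivity), ← mul_assoc]
  congr 1
  rw [← Real.rpow_natCast, ← Real.rpow_neg hl.le, ← Real.rpow_mul hl.le]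
  nth_rewrite 1 [← Real.rpow_one l]
  rw [← Real.rpow_add hl]
  congr 1
  ring

/-- The similarity is moved onto the test function by a change of variables, the chain rule being
needed only for smooth functions; a direction w becomes λ O w. -/
theorem HasWeakGradient.comp_similarity (hp : 1 ≤ p) (hl : 0 < l) (O : Rn n ≃ₗᵢ[ℝ] Rn n)
    (z : Rn n) {u : Rn n → ℝ} {G : Rn n → Rn n} (hu : Continuous u) (h : HasWeakGradient u G)
    (hG : MemLp G (ENNReal.ofReal p) volume) :
    HasWeakGradient (u ∘ similarity l O z) (fun y => l • O.symm (G (similarity l O z y))) := by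
  set S := similarityHomeomorph hl O z with hS
  refine .of_integral_fderiv_apply
    (hu.comp S.continuous).locallyIntegrable
    ((memLp_comp_similarity hl O z hG).locallyIntegrable (by simpa using hp)) fun φ hφ hc w => ?_
  have hSs : ⇑S.symm = fun x => O.symm (l⁻¹ • (x - z)) :=
    funext fun x => similarityHomeomorph_symm_apply hl O z x
  have hψ : ContDiff ℝ ∞ (φ ∘ S.symm) := by
    rw [hSs]
    exact hφ.comp (O.symm.contDiff.comp (by fun_prop))
  have hψc : HasCompactSupport (φ ∘ S.symm) := hc.comp_homeomorph S.symm
  have hφψ : ∀ y, φ y = (φ ∘ S.symm) (similarity l O z y) := fun y => by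
    rw [← coe_similarityHomeomorph hl]
    simp [hS]
  have hd : ∀ y, fderiv ℝ φ y w = fderiv ℝ (φ ∘ S.symm) (similarity l O z y) (l • O w) := by
    intro y
    have h1 : HasFDerivAt (similarity l O z)
        (l • (O.toContinuousLinearEquiv : Rn n →L[ℝ] Rn n)) y :=
      (((O.toContinuousLinearEquiv : Rn n →L[ℝ] Rn n).hasFDerivAt).const_smul l).add_const z
    have h2 := ((hψ.differentiable (by simp) (similarity l O z y)).hasFDerivAt).comp y h1
    have h3 : φ = (φ ∘ S.symm) ∘ similarity l O z := funext hφψ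
    conv_lhs => rw [h3, h2.fderiv]
    simp
  have hin : ∀ y, inner ℝ (l • O.symm (G (similarity l O z y))) w =
      inner ℝ (G (similarity l O z y)) (l • O w) := by
    intro y
    rw [inner_smul_left, inner_smul_right, ← O.inner_map_map, O.apply_symm_apply]
    simp
  have e1 := integral_comp_similarity hl O z
    (fun x => u x * fderiv ℝ (φ ∘ S.symm) x (l • O w))
  have e2 := integral_comp_similarity hl O z
    (fun x => inner ℝ (G x) (l • O w) * (φ ∘ S.symm) x)
  calc ∫ y, (u ∘ similarity l O z) y * fderiv ℝ φ y w
      = (l ^ n)⁻¹ * ∫ x, u x * fderiv ℝ (φ ∘ S.symm) x (l • O w) := by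
        rw [← e1]
        simp only [hd, Function.comp_apply]
    _ = - ((l ^ n)⁻¹ * ∫ x, inner ℝ (G x) (l • O w) * (φ ∘ S.symm) x) := by
        rw [h.integral_fderiv_apply hψ hψc]
        ring
    _ = _ := by
        rw [← e2]
        simp only [hin]
        congr 2
        funext y
        rw [← hφψ y]

theorem sInt_map_similarity (hl : 0 < l) (O : Rn n ≃ₗᵢ[ℝ] Rn n) (z : Rn n) (u : Rn n → ℝ) :
    sInt (ρ.map (similarity l O z)) u = sInt ρ (u ∘ similarity l O z) :=
  (similarityHomeomorph hl O z).measurableEmbedding.integral_map_vectorMeasure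

/-- The translation contributes z times the mass of ρ, which is zero. -/
theorem firstMoment_map_similarity (hρ : Admissible ρ) (hl : 0 < l) (O : Rn n ≃ₗᵢ[ℝ] Rn n)
    (z : Rn n) : firstMoment (ρ.map (similarity l O z)) = l • O (firstMoment ρ) := by
  have h1 : firstMoment (ρ.map (similarity l O z)) = ∫ᵛ y, similarity l O z y ∂<•ρ :=
    (similarityHomeomorph hl O z).measurableEmbedding.integral_map_vectorMeasure
  have hc : Continuous fun y => l • O y := by fun_prop
  have h2 := VectorMeasure.integral_fun_add
    (B := (ContinuousLinearMap.lsmul ℝ ℝ : ℝ →L[ℝ] Rn n →L[ℝ] Rn n).flip)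
    (hρ.integrable hc) (hρ.integrable (continuous_const (y := z)))
  have h3 := hρ.integral_clm_apply continuous_id
    (l • (O.toContinuousLinearEquiv : Rn n →L[ℝ] Rn n))
  rw [VectorMeasure.integral_const, hρ.mass_zero, map_zero, add_zero] at h2
  rw [h1]
  exact h2.trans h3

end Similarity

/-! ### The best constant and the normalized extremals -/

section BestConstant

variable {n : ℕ} {p q : ℝ} {ρ : SignedMeasure (Rn n)}

/-- The factors λ^{1-n/p} from the gradient norm and from the first moment cancel, so all
similarities give the same bound. -/
theorem rhoSeminorm_le (hp : (n : ℝ) < p) (hpq : p.HolderConjugate q) (hρ : Admissible ρ)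
    {u : Rn n → ℝ} (hu : u ∈ homSobolev n p) :
    rhoSeminorm p ρ u ≤ ENNReal.ofReal (sSup (primalValues p ρ) /
      ‖firstMoment ρ‖ ^ (1 - (n : ℝ) / p) * fieldNorm p (weakGrad u)) := by
  refine iSup_le fun l => iSup_le fun hl => iSup_le fun O => iSup_le fun z => ?_
  refine ENNReal.ofReal_le_ofReal ?_
  have hm : 0 < ‖firstMoment ρ‖ := norm_pos_iff.2 hρ.firstMoment_ne_zero
  have hg := (hasWeakGradient_of_mem_homSobolev hu).comp_similarity hpq.lt.le hl O z hu.1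
    (memLp_weakGrad hu)
  have hmem : u ∘ similarity l O z ∈ homSobolev n p :=
    mem_homSobolev (hu.1.comp (similarityHomeomorph hl O z).continuous) hg
      (memLp_comp_similarity hl O z (memLp_weakGrad hu))
  have h := abs_sInt_le hp hpq hρ hmem
  rw [fieldNorm_weakGrad hg, fieldNorm_comp_similarity hpq.pos hl] at h
  rw [sInt_map_similarity hl, firstMoment_map_similarity hρ hl, norm_smul,
    LinearIsometryEquiv.norm_map, Real.norm_of_nonneg hl.le,
    Real.mul_rpow hl.le hm.le, div_le_iff₀ (by positivity)]
  refine h.trans_eq ?_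
  field_simp

theorem ofReal_abs_sInt_div_le_rhoSeminorm (hρ : Admissible ρ) (u : Rn n → ℝ) :
    ENNReal.ofReal (|sInt ρ u| / ‖firstMoment ρ‖ ^ (1 - (n : ℝ) / p)) ≤ rhoSeminorm p ρ u := by
  refine le_iSup_of_le 1 (le_iSup_of_le one_pos
    (le_iSup_of_le (LinearIsometryEquiv.refl ℝ (Rn n)) (le_iSup_of_le 0 ?_)))
  rw [sInt_map_similarity one_pos, firstMoment_map_similarity hρ one_pos]
  have : u ∘ similarity 1 (LinearIsometryEquiv.refl ℝ (Rn n)) 0 = u := by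
    funext x
    simp [similarity]
  rw [this]
  simp

/-- The best constant in the generalized Morrey inequality. -/
theorem isBestConstant (hp : (n : ℝ) < p) (hpq : p.HolderConjugate q) (hρ : Admissible ρ) :
    IsBestConstant p ρ (sSup (primalValues p ρ) /
      ‖firstMoment ρ‖ ^ (1 - (n : ℝ) / p)).toNNReal := by
  have hM := primalValues_sSup_pos hp hpq hρ
  have hC : 0 ≤ sSup (primalValues p ρ) / ‖firstMoment ρ‖ ^ (1 - (n : ℝ) / p) := by positivity
  constructor
  · intro u hu
    refine (rhoSeminorm_le hp hpq hρ hu).trans_eq ?_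
    rw [ENNReal.ofReal_mul hC]
    rfl
  · intro C' hC'
    obtain ⟨v, hv, hv1, hvM⟩ := exists_maximizer hp hpq hρ
    have h := (ofReal_abs_sInt_div_le_rhoSeminorm (p := p) hρ v).trans (hC' v hv)
    rw [hv1, hvM, abs_of_pos hM, ENNReal.ofReal_one, mul_one] at h
    exact ENNReal.coe_le_coe.1 h

/-- For a unit gradient, extremality says that the seminorm equals M / |m|^{1-n/p}, so the
normalization reads ∫ v dρ = M. Conversely, the identity similarity already attains the upper bound.
-/
theorem isNormalizedExtremal_iff (hp : (n : ℝ) < p) (hpq : p.HolderConjugate q)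
    (hρ : Admissible ρ) (v : Rn n → ℝ) :
    IsNormalizedExtremal p ρ v ↔ v ∈ homSobolev n p ∧ fieldNorm p (weakGrad v) = 1 ∧
      sInt ρ v = sSup (primalValues p ρ) := by
  have hM := primalValues_sSup_pos hp hpq hρ
  have hm : 0 < ‖firstMoment ρ‖ := norm_pos_iff.2 hρ.firstMoment_ne_zero
  have hC : 0 ≤ sSup (primalValues p ρ) / ‖firstMoment ρ‖ ^ (1 - (n : ℝ) / p) := by positivity
  have hbest := isBestConstant hp hpq hρ
  constructor
  · rintro ⟨⟨hv, C, hCb, hCv⟩, hv1, hvs⟩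
    refine ⟨hv, hv1, ?_⟩
    rw [IsLeast.unique hCb hbest, hv1, ENNReal.ofReal_one, mul_one] at hCv
    rw [hCv, ENNReal.coe_toReal, Real.coe_toNNReal _ hC] at hvs
    exact ((div_left_inj' (by positivity)).1 hvs).symm
  · rintro ⟨hv, hv1, hvM⟩
    have hrho : rhoSeminorm p ρ v = ENNReal.ofReal (sSup (primalValues p ρ) /
        ‖firstMoment ρ‖ ^ (1 - (n : ℝ) / p)) := by
      refine le_antisymm ?_ ?_
      · simpa [hv1] using rhoSeminorm_le hp hpq hρ hv
      · simpa [hvM, abs_of_pos hM] using ofReal_abs_sInt_div_le_rhoSeminorm (p := p) hρ v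
    refine ⟨⟨hv, _, hbest, ?_⟩, hv1, ?_⟩
    · rw [hrho, hv1, ENNReal.ofReal_one, mul_one]
      rfl
    · rw [hrho, ENNReal.toReal_ofReal hC, hvM]

end BestConstant

end MorreyDuality

theorem mainTheorem11 (n : ℕ) (p q : ℝ) (hp : (n : ℝ) < p) (hpq : 1 / p + 1 / q = 1)
    (ρ : SignedMeasure (MorreyDuality.Rn n)) (hρ : MorreyDuality.Admissible ρ) :
    BddAbove (MorreyDuality.primalValues p ρ) ∧
    (MorreyDuality.dualFields p q ρ).Nonempty ∧
    sSup (MorreyDuality.primalValues p ρ) = sInf (MorreyDuality.dualValues p q ρ) ∧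
    (∃ v, MorreyDuality.IsNormalizedExtremal p ρ v) ∧
    ∀ v, MorreyDuality.IsNormalizedExtremal p ρ v →
      MorreyDuality.sInt ρ v = sSup (MorreyDuality.primalValues p ρ) ∧
      ∃ c : ℝ, 0 < c ∧ ∃ F ∈ MorreyDuality.dualFields p q ρ,
        (F = fun x => -(c • (‖MorreyDuality.weakGrad v x‖ ^ (p - 2) •
          MorreyDuality.weakGrad v x))) ∧
        MorreyDuality.fieldNorm q F = sInf (MorreyDuality.dualValues p q ρ) := by
  -- In dimension zero the first moment would vanish. Hence p > n ≥ 1, so p and q are genuinely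
  -- conjugate exponents.
  have hn : 1 ≤ n := by
    by_contra h
    obtain rfl : n = 0 := by omega
    exact hρ.firstMoment_ne_zero (Subsingleton.elim _ _)
  have hp1 : 1 < p := lt_of_le_of_lt (by exact_mod_cast hn) hp
  have hconj : p.HolderConjugate q := by
    rw [Real.holderConjugate_iff]
    exact ⟨hp1, by simpa using hpq⟩
  obtain ⟨v, hv, hv1, hvM⟩ := MorreyDuality.exists_maximizer hp hconj hρ
  refine ⟨MorreyDuality.bddAbove_primalValues hp hconj hρ,
    ⟨_, MorreyDuality.mem_dualFields_of_maximizer hp hconj hρ hv hv1 hvM⟩,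
    MorreyDuality.sInf_dualValues hp hconj hρ,
    ⟨v, (MorreyDuality.isNormalizedExtremal_iff hp hconj hρ v).2 ⟨hv, hv1, hvM⟩⟩,
    fun w hw => ?_⟩
  obtain ⟨hw0, hw1, hwM⟩ := (MorreyDuality.isNormalizedExtremal_iff hp hconj hρ w).1 hw
  exact ⟨hwM, _, MorreyDuality.primalValues_sSup_pos hp hconj hρ, _,
    MorreyDuality.mem_dualFields_of_maximizer hp hconj hρ hw0 hw1 hwM, rfl,
    (MorreyDuality.fieldNorm_dual_of_maximizer hp hconj hρ hw1).trans
      (MorreyDuality.sInf_dualValues hp hconj hρ)⟩
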